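/- **Theorem.** A *Davenport–Schinzel sequence of order $s\ge 1$* is a finite sequence with no two adjacent equal symbols that contains no alternation $a\ldots b\ldots a\ldots b\ldots$ of length $s+2$ (as a not necessarily contiguous subsequence) for any two distinct symbols $a,b$. Let $\lambda_s(n)$ denote the maximum length of a Davenport–Schinzel sequence of order $s$ on $n$ distinct symbols. Define the Ackermann hierarchy by $A_1(n)=2n$ and $A_k(n)=A_{k-1}^{(n)}(1)$ (the $n$-fold iterate of $A_{k-1}$ applied to $1$) for $k\ge 2$, $n\ge 0$, the Ackermann function by $A(n)=A_n(3)$ for $n\ge 1$, and the inverse Ackermann function by $\alpha(x)=\min\{k\ge 1 : A(k)\ge x\}$. Let $s\ge 3$ be a fixed integer and let $t=\lfloor (s-2)/2\rfloor$. There is a real constant $C$, depending only on $s$, such that for all integers $n\ge 1$ $$ \lambda_s(n)\le \begin{cases} n\cdot 2^{\frac{1}{t!}\alpha(n)^t + C\,\alpha(n)^{t-1}}, & s \text{ even},\\[4pt] n\cdot 2^{\frac{1}{t!}\alpha(n)^t\log_2\alpha(n) + C\,\alpha(n)^{t}}, & s \text{ odd}. \end{cases} $$ -/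

import Mathlib

/-- `u ⊂ S`: some (not necessarily contiguous) subsequence of `S` is obtained from `u` by a
one-to-one renaming of its symbols. -/
def SeqContains (u S : List ℕ) : Prop :=
  ∃ f : ℕ → ℕ, Set.InjOn f {x | x ∈ u} ∧ (u.map f).Sublist S

/-- `S` is `r`-sparse: `S i ≠ S j` whenever `1 ≤ |j - i| ≤ r - 1`. -/
def IsSparse (r : ℕ) (S : List ℕ) : Prop :=
  ∀ i j : Fin S.length, i.val < j.val → j.val < i.val + r → S.get i ≠ S.get j

/-- The alternation `0 1 0 1 0 ⋯` of length `l`. -/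
def alternation (l : ℕ) : List ℕ :=
  (List.range l).map (fun i => i % 2)

/-- Davenport–Schinzel sequences of order `s` (meaningful for `s ≥ 1`): no two adjacent symbols
are equal, and there is no alternation `a … b … a … b …` of length `s + 2` with `a ≠ b`. -/
def IsDavenportSchinzel (s : ℕ) (S : List ℕ) : Prop :=
  IsSparse 2 S ∧ ¬ SeqContains (alternation (s + 2)) S

/-- The lengths of the Davenport–Schinzel sequences of order `s` on `n` distinct symbols. -/
def dsLengths (s n : ℕ) : Set ℕ :=
  {l | ∃ S : List ℕ, IsDavenportSchinzel s S ∧ S.toFinset.card = n ∧ S.length = l}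

/-- `λ_s(n)`: the maximum length of a Davenport–Schinzel sequence of order `s` on `n` distinct
symbols (`isGreatest_dsLambda` below shows that the supremum is a maximum). -/
noncomputable def dsLambda (s n : ℕ) : ℕ :=
  sSup (dsLengths s n)

/-- The Ackermann hierarchy, for `k ≥ 1`: `A_1(n) = 2n` and `A_k(n) = A_{k-1}^{(n)}(1)` for
`k ≥ 2`. (The value at `k = 0` is a placeholder and is never used.) -/
def ackHierarchy : ℕ → ℕ → ℕ
  | 0, _ => 0
  | 1, n => 2 * n
  | k + 2, n => (ackHierarchy (k + 1))^[n] 1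

/-- The Ackermann function `A(n) = A_n(3)`, for `n ≥ 1`. -/
def ackFun (n : ℕ) : ℕ :=
  ackHierarchy n 3

/-- The inverse Ackermann function `α(x) = min {k ≥ 1 | A(k) ≥ x}`
(`isLeast_invAck` below shows that the minimum exists). -/
noncomputable def invAck (x : ℕ) : ℕ :=
  sInf {k : ℕ | 1 ≤ k ∧ x ≤ ackFun k}

theorem dsLengths_nonempty (s n : ℕ) (hs : 1 ≤ s) : (dsLengths s n).Nonempty := by
  refine ⟨n, List.range n, ⟨?_, ?_⟩,
    (List.toFinset_card_of_nodup List.nodup_range).trans List.length_range, List.length_range⟩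
  · intro i j hij _ h
    simp at h
    omega
  · rintro ⟨f, -, hf⟩
    have hnd : ((alternation (s + 2)).map f).Nodup := hf.nodup List.nodup_range
    have := (List.nodup_iff_injective_get.1 hnd)
    have hl : ((alternation (s + 2)).map f).length = s + 2 := by simp [alternation]
    have h02 := @this ⟨0, by omega⟩ ⟨2, by omega⟩ (by
      rw [List.get_eq_getElem, List.get_eq_getElem, List.getElem_map, List.getElem_map]
      simp [alternation])
    exact absurd (congrArg Fin.val h02) (by norm_num)

theorem dsLengths_bddAbove (s n : ℕ) : BddAbove (dsLengths s n) := by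
  refine ⟨n * n * (s + 1) + 1, ?_⟩
  rintro l ⟨S, ⟨hsp, hfree⟩, hn, rfl⟩
  by_contra! hlen
  apply hfree
  have hmap : ∀ i ∈ (Finset.range (S.length - 1)),
      (S.getD i 0, S.getD (i + 1) 0) ∈ S.toFinset ×ˢ S.toFinset := by
    intro i hi
    have hi' := Finset.mem_range.1 hi
    have h1 : i < S.length := by omega
    have h2 : i + 1 < S.length := by omega
    simp [h1, h2]
  have hcard : (S.toFinset ×ˢ S.toFinset).card * (s + 1)
      < (Finset.range (S.length - 1)).card := by
    rw [Finset.card_product, hn, Finset.card_range]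
    omega
  obtain ⟨⟨a, b⟩, -, hab⟩ :=
    Finset.exists_lt_card_fiber_of_mul_lt_card_of_maps_to hmap hcard
  set T := {i ∈ Finset.range (S.length - 1) | (S.getD i 0, S.getD (i + 1) 0) = (a, b)} with hT
  have hTm : ∀ i ∈ T, i + 1 < S.length ∧ S.getD i 0 = a ∧ S.getD (i + 1) 0 = b := by
    intro i hi
    simp only [hT, Finset.mem_filter, Finset.mem_range, Prod.mk.injEq] at hi
    exact ⟨by omega, hi.2⟩
  obtain ⟨T', hT', hc⟩ := Finset.exists_subset_card_eq (show s + 2 ≤ T.card by omega)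
  let e := T'.orderEmbOfFin hc
  have he : ∀ j, e j ∈ T := fun j => hT' (T'.orderEmbOfFin_mem hc j)
  have hne : a ≠ b := by
    obtain ⟨h1, h2, h3⟩ := hTm _ (he 0)
    have := hsp ⟨e 0, by omega⟩ ⟨e 0 + 1, h1⟩ (by simp) (by simp)
    rw [List.getD_eq_getElem _ _ (by omega)] at h2
    rw [List.getD_eq_getElem _ _ h1] at h3
    simpa [h2, h3] using this
  refine ⟨fun x => if x = 0 then a else b, ?_, ?_⟩
  · intro x hx y hy hxy
    simp only [alternation, Set.mem_ofPred_eq, List.mem_map, List.mem_range] at hx hy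
    obtain ⟨i, -, rfl⟩ := hx
    obtain ⟨j, -, rfl⟩ := hy
    rcases Nat.mod_two_eq_zero_or_one i with h | h <;>
      rcases Nat.mod_two_eq_zero_or_one j with h' | h' <;>
      simp_all
  · let p : Fin (s + 2) → ℕ := fun j => e j + j.val % 2
    have hpl : ∀ j, p j < S.length := by
      intro j
      have := (hTm _ (he j)).1
      simp only [p]
      omega
    have hpv : ∀ j, S.getD (p j) 0 = if j.val % 2 = 0 then a else b := by
      intro j
      obtain ⟨-, h2, h3⟩ := hTm _ (he j)
      rcases Nat.mod_two_eq_zero_or_one j.val with h | h <;> simp only [p, h]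
      · simpa using h2
      · simpa using h3
    have hmono : StrictMono p := by
      apply Fin.strictMono_iff_lt_succ.2
      intro i
      have hlt : e i.castSucc < e i.succ := e.strictMono Fin.castSucc_lt_succ
      have hle : p i.castSucc ≤ p i.succ := by
        simp only [p]
        omega
      refine lt_of_le_of_ne hle fun heq => ?_
      have h1 := hpv i.castSucc
      rw [heq, hpv i.succ] at h1
      simp only [Fin.val_succ, Fin.val_castSucc] at h1
      rcases Nat.mod_two_eq_zero_or_one i.val with h | h
      · have : (i.val + 1) % 2 = 1 := by omega
        simp [h, this] at h1
        exact hne h1.symm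
      · have : (i.val + 1) % 2 = 0 := by omega
        simp [h, this] at h1
        exact hne h1
    have hl : ((alternation (s + 2)).map fun x => if x = 0 then a else b).length = s + 2 := by
      simp [alternation]
    rw [List.sublist_iff_exists_fin_orderEmbedding_get_eq]
    refine ⟨OrderEmbedding.ofStrictMono (fun j => ⟨p (Fin.cast hl j), hpl _⟩) ?_, ?_⟩
    · intro j k hjk
      exact hmono (by simpa using hjk)
    · intro j
      have := hpv (Fin.cast hl j)
      rw [List.getD_eq_getElem _ _ (hpl _)] at this
      change _ = S[p (Fin.cast hl j)]'(hpl _)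
      rw [this, List.get_eq_getElem, List.getElem_map]
      simp only [alternation, List.getElem_map, List.getElem_range]
      rfl

theorem isGreatest_dsLambda (s n : ℕ) (hs : 1 ≤ s) :
    IsGreatest (dsLengths s n) (dsLambda s n) :=
  ⟨Nat.sSup_mem (dsLengths_nonempty s n hs) (dsLengths_bddAbove s n),
    fun _ hl => le_csSup (dsLengths_bddAbove s n) hl⟩

theorem ackHierarchy_facts (k : ℕ) :
    ackHierarchy (k + 1) 1 = 2 ∧ ackHierarchy (k + 1) 2 = 4 ∧
      StrictMono (ackHierarchy (k + 1)) := by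
  induction k with
  | zero =>
    refine ⟨rfl, rfl, fun a b h => ?_⟩
    simp only [ackHierarchy]
    omega
  | succ k ih =>
    obtain ⟨h1, h2, hm⟩ := ih
    have hrec : ∀ n, ackHierarchy (k + 2) (n + 1)
        = ackHierarchy (k + 1) (ackHierarchy (k + 2) n) := fun n => by
      simp only [ackHierarchy, Function.iterate_succ_apply']
    have hz : ackHierarchy (k + 2) 0 = 1 := rfl
    have hgt : ∀ n, 1 ≤ n → n < ackHierarchy (k + 1) n := by
      intro n hn
      induction n, hn using Nat.le_induction with
      | base => omega
      | succ n hn ih =>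
        have := hm (Nat.lt_succ_self n)
        simp only [Nat.succ_eq_add_one] at this
        omega
    have hpos : ∀ n, n + 1 ≤ ackHierarchy (k + 2) n := by
      intro n
      induction n with
      | zero => omega
      | succ n ih =>
        rw [hrec]
        have := hgt (ackHierarchy (k + 2) n) (by omega)
        omega
    refine ⟨by rw [hrec, hz, h1], by rw [hrec, hrec, hz, h1, h2], ?_⟩
    refine strictMono_nat_of_lt_succ fun n => ?_
    have := hpos n
    change ackHierarchy (k + 2) n < ackHierarchy (k + 2) (n + 1)
    rw [hrec]
    exact hgt _ (by omega)

theorem isLeast_invAck (x : ℕ) : IsLeast {k : ℕ | 1 ≤ k ∧ x ≤ ackFun k} (invAck x) := by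
  have hgrow : ∀ k, k + 1 ≤ ackFun (k + 1) := by
    intro k
    induction k with
    | zero => simp [ackFun, ackHierarchy]
    | succ k ih =>
      obtain ⟨h1, h2, hm⟩ := ackHierarchy_facts k
      have h3 : ackFun (k + 2) = ackHierarchy (k + 1) 4 := by
        simp only [ackFun, ackHierarchy, Function.iterate_succ_apply, Function.iterate_zero, id,
          h1, h2]
      have h4 : ackFun (k + 1) < ackHierarchy (k + 1) 4 := hm (by norm_num)
      change k + 1 + 1 ≤ ackFun (k + 2)
      omega
  have hne : {k : ℕ | 1 ≤ k ∧ x ≤ ackFun k}.Nonempty :=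
    ⟨x + 1, by omega, by have := hgrow x; omega⟩
  exact ⟨Nat.sInf_mem hne, fun k hk => Nat.sInf_le hk⟩

/-! The proof counts symbols instead of length. Take a sequence cut into `m` blocks, each with
distinct symbols, without alternations of length `s + 2`. `HeavyBound s Q m N` bounds by `N` the
number of symbols that occur more than `Q` times.

The engine is `HeavyBound.step`. Group the blocks into layers. A symbol with few occurrences inside
every single layer, which also meets few layers, occurs few times in total. In its first layer it
still has a later occurrence, in its last layer an earlier one, and in a middle layer both; each
outside occurrence lowers the order by one. The symbols that meet many layers are counted in the
contracted sequence, whose blocks are the layers. Iterating this with layer sizes taken from the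
Ackermann hierarchy gives `heavyBound_of_le_ackHierarchy`: for the multiplicities `heavyThreshold s
d`, the count is linear in `m` as long as `m` is below Ackermann size at level `d`.

Conversely, `card_le_of_heavyBound` turns such a count into a length bound. To reach a sequence
without adjacent repetitions, cut it greedily into segments of order `s - 2`. There are at most `2n`
of them (`card_greedy_partition_le`), and induction on the order bounds each segment by its number
of distinct symbols. Keeping one representative of each symbol per segment leaves a block sequence,
so `card_le_mul_lengthFactor` gives length at most `n * lengthFactor s (invAck n)`.

What remains is growth: up to a constant factor, the threshold of order `s + 2` at `d + 1` is at
most the threshold of order `s` at `d + 1` times that of order `s + 2` at `d`. Hence logarithms are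
summed over `d` once for every two orders, which produces `d ^ t / t!`; for odd orders the linear
threshold of order 3 adds the factor `logb 2 d`. -/

/-! ### Alternations and heavy symbols. -/

/-- The positions `g 0 < g 1 < ⋯ < g (l - 1)` of `X` carry the symbols `a, b, a, b, …`. -/
def IsAlternation (l : ℕ) (X : Finset ℕ) (c : ℕ → ℕ) (a b : ℕ) (g : ℕ → ℕ) : Prop :=
  (∀ i, i + 1 < l → g i < g (i + 1)) ∧ ∀ i < l, g i ∈ X ∧ c (g i) = if i % 2 = 0 then a else b

/-- The sequence `c` restricted to the positions in `X` has no alternation of length `l`. -/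
def AltFree (l : ℕ) (X : Finset ℕ) (c : ℕ → ℕ) : Prop :=
  ∀ a b g, a ≠ b → ¬ IsAlternation l X c a b g

/-- The symbols that occur more than `Q` times in the positions `X`. -/
def heavy (Q : ℕ) (X : Finset ℕ) (c : ℕ → ℕ) : Finset ℕ :=
  (X.image c).filter fun a => Q < (X.filter fun x => c x = a).card

/-- A sequence of at most `m` blocks, each of distinct symbols, without alternations of length
`s + 2`, has at most `N` symbols that occur more than `Q` times. -/
def HeavyBound (s Q m N : ℕ) : Prop :=
  ∀ (X : Finset ℕ) (c β : ℕ → ℕ), Monotone β → Set.InjOn (fun x => (c x, β x)) X →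
    (X.image β).card ≤ m → AltFree (s + 2) X c → (heavy Q X c).card ≤ N

theorem mem_heavy {Q : ℕ} {X : Finset ℕ} {c : ℕ → ℕ} {a : ℕ} :
    a ∈ heavy Q X c ↔ Q < (X.filter fun x => c x = a).card := by
  simp only [heavy, Finset.mem_filter, Finset.mem_image, and_iff_right_iff_imp]
  intro h
  obtain ⟨x, hx⟩ := Finset.card_pos.1 (Nat.zero_lt_of_lt h)
  exact ⟨x, (Finset.mem_filter.1 hx).1, (Finset.mem_filter.1 hx).2⟩

theorem AltFree.subset {l : ℕ} {X Y : Finset ℕ} {c : ℕ → ℕ} (h : AltFree l X c) (hYX : Y ⊆ X) :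
    AltFree l Y c :=
  fun a b g hab hg => h a b g hab ⟨hg.1, fun i hi => ⟨hYX (hg.2 i hi).1, (hg.2 i hi).2⟩⟩

theorem AltFree.mono {l l' : ℕ} {X : Finset ℕ} {c : ℕ → ℕ} (h : AltFree l X c) (hl : l ≤ l') :
    AltFree l' X c :=
  fun a b g hab hg =>
    h a b g hab ⟨fun i hi => hg.1 i (by omega), fun i hi => hg.2 i (by omega)⟩

/-- The symbol at index `l - 2` is the one due next in the alternation, so its occurrence beyond all
of `Y` extends the alternation by one term. -/
theorem AltFree.of_later {l : ℕ} {X Y : Finset ℕ} {c : ℕ → ℕ} (hl : 2 ≤ l)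
    (h : AltFree (l + 1) X c) (hYX : Y ⊆ X)
    (hlater : ∀ x ∈ Y, ∃ y ∈ X, c y = c x ∧ ∀ z ∈ Y, z < y) : AltFree l Y c := by
  rintro a b g hab ⟨hg, hc⟩
  obtain ⟨y, hyX, hcy, hy⟩ := hlater (g (l - 2)) (hc (l - 2) (by omega)).1
  refine h a b (fun i => if i < l then g i else y) hab ⟨fun i hi => ?_, fun i hi => ?_⟩
  · by_cases h1 : i + 1 < l
    · simpa [h1, show i < l by omega] using hg i h1
    · simpa [h1, show i < l by omega] using hy _ (hc i (by omega)).1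
  · by_cases h1 : i < l
    · simpa [h1] using ⟨hYX (hc i h1).1, (hc i h1).2⟩
    · have := (hc (l - 2) (by omega)).2
      obtain rfl : i = l := by omega
      rw [show (i - 2) % 2 = i % 2 by omega, ← hcy] at this
      simpa [hyX] using this

/-- Mirror image: an earlier occurrence of the symbol at index 1 is put in front, which swaps the
roles of `a` and `b`. -/
theorem AltFree.of_earlier {l : ℕ} {X Y : Finset ℕ} {c : ℕ → ℕ} (hl : 2 ≤ l)
    (h : AltFree (l + 1) X c) (hYX : Y ⊆ X)
    (hearlier : ∀ x ∈ Y, ∃ y ∈ X, c y = c x ∧ ∀ z ∈ Y, y < z) : AltFree l Y c := by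
  rintro a b g hab ⟨hg, hc⟩
  obtain ⟨y, hyX, hcy, hy⟩ := hearlier (g 1) (hc 1 (by omega)).1
  refine h b a (fun i => if i = 0 then y else g (i - 1)) hab.symm ⟨fun i hi => ?_, fun i hi => ?_⟩
  · rcases i with _ | i
    · simpa using hy _ (hc 0 (by omega)).1
    · simpa using hg i (by omega)
  · rcases i with _ | i
    · simpa [hyX, hcy] using (hc 1 (by omega)).2
    · have := hc i (by omega)
      refine ⟨by simpa using hYX this.1, ?_⟩
      simp only [Nat.add_eq_zero_iff, one_ne_zero, and_false, if_false, Nat.add_sub_cancel, this.2]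
      rcases Nat.mod_two_eq_zero_or_one i with h | h <;> simp [h, Nat.add_mod]

theorem HeavyBound.mono {s Q m N m' N' : ℕ} (h : HeavyBound s Q m N) (hm : m' ≤ m)
    (hN : N ≤ N') : HeavyBound s Q m' N' :=
  fun X c β hβ hi hc ha => (h X c β hβ hi (hc.trans hm) ha).trans hN

/-- A symbol occurs at most once per block. -/
theorem HeavyBound.of_le {s Q m : ℕ} (h : m ≤ Q) : HeavyBound s Q m 0 := by
  intro X c β hβ hi hc ha
  rw [Nat.le_zero, Finset.card_eq_zero, Finset.eq_empty_iff_forall_notMem]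
  intro a hm
  rw [mem_heavy] at hm
  have : (X.filter fun x => c x = a).card ≤ (X.image β).card := by
    refine Finset.card_le_card_of_injOn β (fun x hx => ?_) fun x hx y hy hxy => ?_
    · exact Finset.mem_coe.2 (Finset.mem_image_of_mem _ (Finset.mem_filter.1 hx).1)
    · simp only [Finset.coe_filter, Set.mem_ofPred_eq] at hx hy
      exact hi hx.1 hy.1 (by simp [hx.2, hy.2, hxy])
  omega

theorem AltFree.false_of_three {X : Finset ℕ} {c : ℕ → ℕ} (h : AltFree 3 X c) {x y z : ℕ}
    (hx : x ∈ X) (hy : y ∈ X) (hz : z ∈ X) (hxy : x < y) (hyz : y < z) (hc : c x = c z)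
    (hne : c x ≠ c y) : False := by
  refine h (c x) (c y) (fun i => if i = 0 then x else if i = 1 then y else z) hne
    ⟨fun i hi => ?_, fun i hi => ?_⟩
  · have : i < 2 := by omega
    interval_cases i <;> simp [hxy, hyz]
  · interval_cases i <;> simp [hx, hy, hz, hc]

theorem AltFree.false_of_four {X : Finset ℕ} {c : ℕ → ℕ} (h : AltFree 4 X c) {x y z w : ℕ}
    (hx : x ∈ X) (hy : y ∈ X) (hz : z ∈ X) (hw : w ∈ X) (hxy : x < y) (hyz : y < z) (hzw : z < w)
    (hc : c x = c z) (hc' : c y = c w) (hne : c x ≠ c y) : False := by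
  refine h (c x) (c y) (fun i => if i = 0 then x else if i = 1 then y else if i = 2 then z else w)
    hne ⟨fun i hi => ?_, fun i hi => ?_⟩
  · have : i < 3 := by omega
    interval_cases i <;> simp [hxy, hyz, hzw]
  · interval_cases i <;> simp [hx, hy, hz, hw, hc, hc']

/-- Positions of one symbol lie in blocks that increase strictly. -/
theorem block_lt_of_lt {X : Finset ℕ} {c β : ℕ → ℕ} (hβ : Monotone β)
    (hi : Set.InjOn (fun x => (c x, β x)) X) {x y : ℕ} (hx : x ∈ X) (hy : y ∈ X) (hc : c x = c y)
    (hxy : x < y) : β x < β y :=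
  lt_of_le_of_ne (hβ hxy.le) fun h => hxy.ne (hi hx hy (by simp [hc, h]))

/-! ### Orders one and two. -/

/-- Charge each repeated symbol to the block of a non-first occurrence. If `a` precedes `b` in one
such block, the earlier `b` lies in an earlier block and yields `b a b`. -/
theorem heavyBound_one (m : ℕ) : HeavyBound 1 1 m m := by
  intro X c β hβ hi hc ha
  have key : ∀ a ∈ heavy 1 X c, ∃ x y, x ∈ X ∧ y ∈ X ∧ c x = a ∧ c y = a ∧ y < x := by
    intro a h
    obtain ⟨x, hx, y, hy, hne⟩ := Finset.one_lt_card.1 (mem_heavy.1 h)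
    simp only [Finset.mem_filter] at hx hy
    rcases lt_or_gt_of_ne hne with h | h
    · exact ⟨y, x, hy.1, hx.1, hy.2, hx.2, h⟩
    · exact ⟨x, y, hx.1, hy.1, hx.2, hy.2, h⟩
  choose! f e hf he hcf hce hlt using key
  refine le_trans (Finset.card_le_card_of_injOn (fun a => β (f a))
    (fun a h => Finset.mem_coe.2 (Finset.mem_image_of_mem _ (hf a h))) ?_) hc
  have main : ∀ a ∈ heavy 1 X c, ∀ b ∈ heavy 1 X c, β (f a) = β (f b) → f a < f b → a = b := by
    intro a h b h' hab hl
    by_contra hne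
    have h1 := block_lt_of_lt hβ hi (he b h') (hf b h') ((hce b h').trans (hcf b h').symm)
      (hlt b h')
    have h2 : e b < f a := hβ.reflect_lt (hab ▸ h1)
    exact ha.false_of_three (he b h') (hf a h) (hf b h') h2 hl
      ((hce b h').trans (hcf b h').symm) (by rw [hce b h', hcf a h]; exact Ne.symm hne)
  intro a h b h' hab
  rcases lt_trichotomy (f a) (f b) with hl | hl | hl
  · exact main a h b h' hab hl
  · rw [← hcf a h, ← hcf b h', hl]
  · exact (main b h' a h hab.symm hl).symm

/-- As for order one, but charging to a middle occurrence: two symbols charged to one block would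
give `b a b a`. -/
theorem heavyBound_two (m : ℕ) : HeavyBound 2 2 m m := by
  intro X c β hβ hi hc ha
  have key : ∀ a ∈ heavy 2 X c, ∃ x y z, x ∈ X ∧ y ∈ X ∧ z ∈ X ∧ c x = a ∧ c y = a ∧ c z = a ∧
      y < x ∧ x < z := by
    intro a h
    have h := mem_heavy.1 h
    set T := X.filter fun x => c x = a
    have hT : T.Nonempty := Finset.card_pos.1 (by omega)
    have h2 : 0 < ((T.erase (T.min' hT)).erase (T.max' hT)).card := by
      have := Finset.pred_card_le_card_erase (s := T) (a := T.min' hT)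
      have := Finset.pred_card_le_card_erase (s := T.erase (T.min' hT)) (a := T.max' hT)
      omega
    obtain ⟨x, hx⟩ := Finset.card_pos.1 h2
    simp only [Finset.mem_erase] at hx
    have h3 := Finset.mem_filter.1 hx.2.2
    have h4 := Finset.mem_filter.1 (T.min'_mem hT)
    have h5 := Finset.mem_filter.1 (T.max'_mem hT)
    exact ⟨x, T.min' hT, T.max' hT, h3.1, h4.1, h5.1, h3.2, h4.2, h5.2,
      lt_of_le_of_ne (T.min'_le _ hx.2.2) (Ne.symm hx.2.1),
      lt_of_le_of_ne (T.le_max' _ hx.2.2) hx.1⟩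
  choose! f e g hf he hg hcf hce hcg hlt hgt using key
  refine le_trans (Finset.card_le_card_of_injOn (fun a => β (f a))
    (fun a h => Finset.mem_coe.2 (Finset.mem_image_of_mem _ (hf a h))) ?_) hc
  have main : ∀ a ∈ heavy 2 X c, ∀ b ∈ heavy 2 X c, β (f a) = β (f b) → f a < f b → a = b := by
    intro a h b h' hab hl
    by_contra hne
    have h1 := block_lt_of_lt hβ hi (he b h') (hf b h') ((hce b h').trans (hcf b h').symm)
      (hlt b h')
    have h2 : e b < f a := hβ.reflect_lt (hab ▸ h1)
    have h3 := block_lt_of_lt hβ hi (hf a h) (hg a h) ((hcf a h).trans (hcg a h).symm)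
      (hgt a h)
    have h4 : f b < g a := hβ.reflect_lt (hab ▸ h3)
    exact ha.false_of_four (he b h') (hf a h) (hf b h') (hg a h) h2 hl h4
      ((hce b h').trans (hcf b h').symm) ((hcf a h).trans (hcg a h).symm)
      (by rw [hce b h', hcf a h]; exact Ne.symm hne)
  intro a h b h' hab
  rcases lt_trichotomy (f a) (f b) with hl | hl | hl
  · exact main a h b h' hab hl
  · rw [← hcf a h, ← hcf b h', hl]
  · exact (main b h' a h hab.symm hl).symm

/-! ### Ranks, for cutting a finite set into consecutive groups. -/

/-- The number of elements of `B` below `b`. -/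
def rankIn (B : Finset ℕ) (b : ℕ) : ℕ := (B.filter fun x => x < b).card

theorem rankIn_mono (B : Finset ℕ) : Monotone (rankIn B) := fun _ _ h =>
  Finset.card_le_card fun _ hx => by
    simp only [Finset.mem_filter] at hx ⊢
    exact ⟨hx.1, hx.2.trans_le h⟩

theorem rankIn_lt {B : Finset ℕ} {b b' : ℕ} (hb : b ∈ B) (h : b < b') : rankIn B b < rankIn B b' := by
  refine Finset.card_lt_card (Finset.ssubset_iff_of_subset (fun x hx => ?_) |>.2 ⟨b, ?_, ?_⟩)
  · simp only [Finset.mem_filter] at hx ⊢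
    exact ⟨hx.1, hx.2.trans h⟩
  · simp [hb, h]
  · simp

theorem rankIn_injOn (B : Finset ℕ) : Set.InjOn (rankIn B) B := by
  intro b hb b' hb' h
  rcases lt_trichotomy b b' with hl | hl | hl
  · exact absurd h (rankIn_lt hb hl).ne
  · exact hl
  · exact absurd h (rankIn_lt hb' hl).ne'

theorem image_rankIn (B : Finset ℕ) : B.image (rankIn B) = Finset.range B.card := by
  refine Finset.eq_of_subset_of_card_le (fun r hr => ?_) ?_
  · obtain ⟨b, hb, rfl⟩ := Finset.mem_image.1 hr
    rw [Finset.mem_range]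
    exact Finset.card_lt_card (Finset.filter_ssubset.2 ⟨b, hb, lt_irrefl b⟩)
  · rw [Finset.card_range, Finset.card_image_of_injOn (rankIn_injOn B)]

theorem card_rankIn_fiber (B : Finset ℕ) (p : ℕ → Prop) [DecidablePred p] :
    (B.filter fun b => p (rankIn B b)).card = ((Finset.range B.card).filter p).card := by
  rw [← image_rankIn, Finset.filter_image,
    Finset.card_image_of_injOn ((rankIn_injOn B).mono (Finset.filter_subset _ _))]

theorem card_range_filter_div (n k j : ℕ) (hk : 0 < k) :
    ((Finset.range n).filter fun r => r / k = j).card ≤ k := by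
  refine (Finset.card_le_card (t := Finset.Ico (j * k) (j * k + k)) fun r hr => ?_).trans_eq (by simp)
  simp only [Finset.mem_filter, Finset.mem_Ico, Nat.div_eq_iff hk] at hr ⊢
  omega

/-! ### The recurrence over layers. -/

/-- A symbol that escapes the four local counts of every layer and meets at most `Q₃` layers either
lies in one layer, where it is not heavy, or occurs at most `Q₁` times in each of its two extreme
layers and `Q₂` times in each other one. The local counts give `4 * F` per block, the contracted
sequence gives `N`. -/
theorem HeavyBound.step {s Q₁ Q₂ Q₃ ℓ q m F N : ℕ} (hs : 1 ≤ s) (hℓ : 0 < ℓ) (hm : m ≤ q * ℓ)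
    (h₀ : ∀ k ≤ ℓ, HeavyBound (s + 2) (2 * Q₁ + Q₂ * Q₃) k (k * F))
    (h₁ : ∀ k ≤ ℓ, HeavyBound (s + 1) Q₁ k (k * F))
    (h₂ : ∀ k ≤ ℓ, HeavyBound s Q₂ k (k * F))
    (h₃ : HeavyBound (s + 2) Q₃ q N) :
    HeavyBound (s + 2) (2 * Q₁ + Q₂ * Q₃) m (m * (4 * F) + N) := by
  classical
  intro X c β hβ hi hc ha
  set B := X.image β
  let layer : ℕ → ℕ := fun x => rankIn B (β x) / ℓ
  have hlayer : Monotone layer := fun x y h => Nat.div_le_div_right (rankIn_mono B (hβ h))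
  set J := X.image layer
  have hJq : J.card ≤ q := by
    refine (Finset.card_le_card (t := Finset.range q) fun j hj => ?_).trans_eq (by simp)
    obtain ⟨x, hx, rfl⟩ := Finset.mem_image.1 hj
    have : rankIn B (β x) ∈ Finset.range B.card :=
      image_rankIn B ▸ Finset.mem_image_of_mem _ (Finset.mem_image_of_mem _ hx)
    rw [Finset.mem_range] at this ⊢
    exact Nat.div_lt_of_lt_mul (by nlinarith)
  let Y : ℕ → Finset ℕ := fun j => X.filter fun x => layer x = j
  let later : ℕ → ℕ → Prop := fun j x => ∃ y ∈ X, c y = c x ∧ j < layer y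
  let earlier : ℕ → ℕ → Prop := fun j x => ∃ y ∈ X, c y = c x ∧ layer y < j
  let K : ℕ → ℕ := fun j => ((Y j).image β).card
  have hKeq : ∀ j, (Y j).image β = B.filter fun b => rankIn B b / ℓ = j := by
    intro j
    simp only [Y, B, Finset.filter_image, layer]
  have hK : ∀ j, K j ≤ ℓ := by
    intro j
    simp only [K, hKeq]
    rw [card_rankIn_fiber B fun r => r / ℓ = j]
    exact card_range_filter_div _ _ _ hℓ
  have hKsum : ∑ j ∈ J, K j ≤ m := by
    refine le_trans (le_of_eq ?_) hc
    rw [Finset.card_eq_sum_card_fiberwise (f := fun b => rankIn B b / ℓ) (t := J)]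
    · simp only [K, hKeq]
    · intro b hb
      obtain ⟨x, hx, rfl⟩ := Finset.mem_image.1 hb
      exact Finset.mem_coe.2 (Finset.mem_image_of_mem layer hx)
  have hsub : ∀ j, Y j ⊆ X := fun j => Finset.filter_subset _ _
  -- All layers up to `j` are kept, not only layer `j`: `hM` applies `of_earlier` inside this set,
  -- which must contain the earlier occurrences.
  have hR : ∀ j, AltFree (s + 1 + 2) (X.filter fun x => layer x ≤ j ∧ later j x) c := by
    intro j
    refine ha.of_later (by omega) (Finset.filter_subset _ _) fun x hx => ?_
    obtain ⟨y, hy, hcy, hjy⟩ := (Finset.mem_filter.1 hx).2.2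
    exact ⟨y, hy, hcy, fun z hz =>
      hlayer.reflect_lt ((Finset.mem_filter.1 hz).2.1.trans_lt hjy)⟩
  have hL : ∀ j, AltFree (s + 1 + 2) ((Y j).filter (earlier j)) c := by
    intro j
    refine ha.of_earlier (by omega) ((Finset.filter_subset _ _).trans (hsub j)) fun x hx => ?_
    obtain ⟨y, hy, hcy, hjy⟩ := (Finset.mem_filter.1 hx).2
    refine ⟨y, hy, hcy, fun z hz => hlayer.reflect_lt (hjy.trans_le ?_)⟩
    exact (Finset.mem_filter.1 (Finset.mem_filter.1 hz).1).2.ge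
  have hM : ∀ j, AltFree (s + 2) ((Y j).filter fun x => later j x ∧ earlier j x) c := by
    intro j
    refine (hR j).of_earlier (by omega) (fun x hx => ?_) fun x hx => ?_
    · simp only [Y, Finset.mem_filter] at hx ⊢
      exact ⟨hx.1.1, hx.1.2.le, hx.2.1⟩
    · have hx := (Finset.mem_filter.1 hx).2
      obtain ⟨y, hy, hcy, hjy⟩ := hx.2
      refine ⟨y, Finset.mem_filter.2 ⟨hy, hjy.le, ?_⟩, hcy, fun z hz =>
        hlayer.reflect_lt (hjy.trans_le ?_)⟩
      · obtain ⟨w, hw, hcw, hjw⟩ := hx.1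
        exact ⟨w, hw, hcw.trans hcy.symm, hjw⟩
      · exact (Finset.mem_filter.1 (Finset.mem_filter.1 hz).1).2.ge
  -- The contracted sequence: one representative for each symbol in each layer.
  obtain ⟨X', hX', hinj', himg'⟩ := Finset.exists_subset_injOn_image_eq_of_surjOn (X : Set ℕ)
    (X.image fun x => (c x, layer x)) (by rw [Finset.coe_image]; exact Set.surjOn_image _ _)
  rw [Finset.coe_subset] at hX'
  let U : ℕ → Finset ℕ := fun j => heavy (2 * Q₁ + Q₂ * Q₃) (Y j) c ∪
    heavy Q₁ ((Y j).filter (later j)) c ∪ heavy Q₁ ((Y j).filter (earlier j)) c ∪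
    heavy Q₂ ((Y j).filter fun x => later j x ∧ earlier j x) c
  have hbl : ∀ j, ∀ Z ⊆ Y j, (Z.image β).card ≤ K j := fun j Z hZ =>
    Finset.card_le_card (Finset.image_subset_image hZ)
  have hU : ∀ j, (U j).card ≤ K j * (4 * F) := by
    intro j
    have e₀ := h₀ _ (hK j) (Y j) c β hβ (hi.mono (hsub j)) (hbl j _ subset_rfl)
      (ha.subset (hsub j))
    have e₁ := h₁ _ (hK j) ((Y j).filter (later j)) c β hβ
      (hi.mono ((Finset.filter_subset _ _).trans (hsub j))) (hbl j _ (Finset.filter_subset _ _))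
      ((hR j).subset fun x hx => by
        simp only [Y, Finset.mem_filter] at hx ⊢
        exact ⟨hx.1.1, hx.1.2.le, hx.2⟩)
    have e₂ := h₁ _ (hK j) ((Y j).filter (earlier j)) c β hβ
      (hi.mono ((Finset.filter_subset _ _).trans (hsub j))) (hbl j _ (Finset.filter_subset _ _))
      (hL j)
    have e₃ := h₂ _ (hK j) ((Y j).filter fun x => later j x ∧ earlier j x) c β hβ
      (hi.mono ((Finset.filter_subset _ _).trans (hsub j))) (hbl j _ (Finset.filter_subset _ _))
      (hM j)
    have u₁ := Finset.card_union_le (heavy (2 * Q₁ + Q₂ * Q₃) (Y j) c)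
      (heavy Q₁ ((Y j).filter (later j)) c)
    have u₂ := Finset.card_union_le (heavy (2 * Q₁ + Q₂ * Q₃) (Y j) c ∪
      heavy Q₁ ((Y j).filter (later j)) c) (heavy Q₁ ((Y j).filter (earlier j)) c)
    have u₃ := Finset.card_union_le (heavy (2 * Q₁ + Q₂ * Q₃) (Y j) c ∪
      heavy Q₁ ((Y j).filter (later j)) c ∪ heavy Q₁ ((Y j).filter (earlier j)) c)
      (heavy Q₂ ((Y j).filter fun x => later j x ∧ earlier j x) c)
    have : (U j).card = _ := rfl
    simp only [U] at this ⊢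
    linarith
  have hX'bound : (heavy Q₃ X' c).card ≤ N :=
    h₃ X' c layer hlayer hinj' ((Finset.card_le_card (Finset.image_subset_image hX')).trans hJq)
      (ha.subset hX')
  have hcover : heavy (2 * Q₁ + Q₂ * Q₃) X c ⊆ J.biUnion U ∪ heavy Q₃ X' c := by
    intro a haH
    by_contra hna
    simp only [Finset.mem_union, Finset.mem_biUnion, not_or, not_exists, not_and, U, mem_heavy,
      not_lt] at hna
    obtain ⟨hna, hscat⟩ := hna
    rw [mem_heavy] at haH
    set T := X.filter fun x => c x = a
    have hT : T.Nonempty := Finset.card_pos.1 (by omega)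
    have hLa : (T.image layer).Nonempty := hT.image _
    set f := (T.image layer).min' hLa
    set l := (T.image layer).max' hLa
    have hcardL : (T.image layer).card ≤ Q₃ := by
      refine le_trans (le_trans (Finset.card_le_card ?_) (Finset.card_image_le (f := layer))) hscat
      intro j hj
      obtain ⟨x, hx, rfl⟩ := Finset.mem_image.1 hj
      have hx := Finset.mem_filter.1 hx
      have : (c x, layer x) ∈ X'.image fun x => (c x, layer x) :=
        himg' ▸ Finset.mem_image_of_mem _ hx.1
      obtain ⟨x', hx', he⟩ := Finset.mem_image.1 this
      simp only [Prod.mk.injEq] at he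
      exact Finset.mem_image.2 ⟨x', Finset.mem_filter.2 ⟨hx', he.1.trans hx.2⟩, he.2⟩
    have hfl : f < l := by
      by_contra hle
      have hone : ∀ x ∈ T, layer x = f := fun x hx =>
        le_antisymm (((T.image layer).le_max' _ (Finset.mem_image_of_mem _ hx)).trans
          (not_lt.1 hle)) ((T.image layer).min'_le _ (Finset.mem_image_of_mem _ hx))
      obtain ⟨x, hx⟩ := hT
      have := (hna f (hone x hx ▸ Finset.mem_image_of_mem _ (Finset.mem_filter.1 hx).1)).1.1.1
      refine absurd (haH.trans_le (Finset.card_le_card fun y hy => ?_)) (not_lt.2 this)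
      have hy' := Finset.mem_filter.1 hy
      exact Finset.mem_filter.2 ⟨Finset.mem_filter.2 ⟨hy'.1, hone y hy⟩, hy'.2⟩
    obtain ⟨xf, hxf, hxff⟩ := Finset.mem_image.1 ((T.image layer).min'_mem hLa)
    obtain ⟨xl, hxl, hxll⟩ := Finset.mem_image.1 ((T.image layer).max'_mem hLa)
    have hxf := Finset.mem_filter.1 hxf
    have hxl := Finset.mem_filter.1 hxl
    have hlat : ∀ j < l, ∀ x, c x = a → later j x := fun j hj x hx =>
      ⟨xl, hxl.1, hxl.2.trans hx.symm, hj.trans_eq hxll.symm⟩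
    have hear : ∀ j, f < j → ∀ x, c x = a → earlier j x := fun j hj x hx =>
      ⟨xf, hxf.1, hxf.2.trans hx.symm, hxff.trans_lt hj⟩
    have hterm : ∀ j ∈ T.image layer, (T.filter fun x => layer x = j).card ≤
        (if j = f then Q₁ else 0) + (if j = l then Q₁ else 0) + Q₂ := by
      intro j hj
      have hjJ : j ∈ J := Finset.image_subset_image (Finset.filter_subset _ _) hj
      have hf : f ≤ j := (T.image layer).min'_le _ hj
      have hl : j ≤ l := (T.image layer).le_max' _ hj
      obtain ⟨⟨⟨-, b₁⟩, b₂⟩, b₃⟩ := hna j hjJ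
      by_cases h1 : j < l
      · by_cases h2 : f < j
        · refine le_trans (le_trans (Finset.card_le_card fun x hx => ?_) b₃) (by omega)
          simp only [T, Y, Finset.mem_filter] at hx ⊢
          exact ⟨⟨⟨hx.1.1, hx.2⟩, hlat j h1 x hx.1.2, hear j h2 x hx.1.2⟩, hx.1.2⟩
        · refine le_trans (le_trans (Finset.card_le_card fun x hx => ?_) b₁)
            (by rw [if_pos (by omega : j = f)]; omega)
          simp only [T, Y, Finset.mem_filter] at hx ⊢
          exact ⟨⟨⟨hx.1.1, hx.2⟩, hlat j h1 x hx.1.2⟩, hx.1.2⟩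
      · have hjl : j = l := by omega
        refine le_trans (le_trans (Finset.card_le_card fun x hx => ?_) b₂)
          (by rw [if_pos hjl]; omega)
        simp only [T, Y, Finset.mem_filter] at hx ⊢
        exact ⟨⟨⟨hx.1.1, hx.2⟩, hear j (by omega) x hx.1.2⟩, hx.1.2⟩
    have hsum : T.card ≤ Q₁ + Q₁ + (T.image layer).card * Q₂ := by
      rw [Finset.card_eq_sum_card_image layer T]
      refine (Finset.sum_le_sum hterm).trans ?_
      rw [Finset.sum_add_distrib, Finset.sum_add_distrib, Finset.sum_ite_eq',
        Finset.sum_ite_eq', Finset.sum_const, smul_eq_mul]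
      gcongr <;> split_ifs <;> omega
    have := Nat.mul_le_mul_right Q₂ hcardL
    linarith
  refine (Finset.card_le_card hcover).trans ((Finset.card_union_le _ _).trans
    (add_le_add ?_ hX'bound))
  refine Finset.card_biUnion_le.trans ((Finset.sum_le_sum fun j _ => hU j).trans ?_)
  rw [← Finset.sum_mul]
  gcongr

/-! ### Thresholds and the Ackermann hierarchy. -/

/-- Multiplicities for which the number of symbols is linear in the number of blocks. -/
def heavyThreshold : ℕ → ℕ → ℕ
  | 0, _ => 1
  | 1, _ => 1
  | 2, _ => 2
  | _ + 3, 0 => 25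
  | s + 3, d + 1 =>
    2 * heavyThreshold (s + 2) (d + 1) + heavyThreshold (s + 1) (d + 1) * heavyThreshold (s + 3) d

theorem heavyThreshold_pos (s d : ℕ) : 1 ≤ heavyThreshold s d := by
  induction s using Nat.strong_induction_on generalizing d with
  | _ s ih =>
    match s, d with
    | 0, _ => simp [heavyThreshold]
    | 1, _ => simp [heavyThreshold]
    | 2, _ => simp [heavyThreshold]
    | s + 3, 0 => simp [heavyThreshold]
    | s + 3, d + 1 =>
      rw [heavyThreshold]
      have := ih (s + 2) (by omega) (d + 1)
      omega

theorem heavyThreshold_mono (s : ℕ) : Monotone (heavyThreshold s) := by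
  refine monotone_nat_of_le_succ fun d => ?_
  match s with
  | 0 => simp [heavyThreshold]
  | 1 => simp [heavyThreshold]
  | 2 => simp [heavyThreshold]
  | s + 3 =>
    rw [heavyThreshold]
    have := Nat.mul_le_mul_right (heavyThreshold (s + 3) d) (heavyThreshold_pos (s + 1) (d + 1))
    omega

theorem heavyThreshold_ge (s d : ℕ) : 25 ≤ heavyThreshold (s + 3) d := by
  have := heavyThreshold_mono (s + 3) (Nat.zero_le d)
  rwa [heavyThreshold] at this

/-- Triple induction on order, level and argument. Layers have the size already handled at `w`, and
the contracted sequence is handled at level `d - 1` with argument `ackHierarchy (d + 1) w`. One step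
turns `5 ^ w` into `4 * 5 ^ w` plus at most one more per block, which is why the base is 5. -/
theorem heavyBound_of_le_ackHierarchy (s d w m : ℕ)
    (hm : m ≤ 2 * 5 ^ ackHierarchy (d + 1) w) :
    HeavyBound (s + 1) (heavyThreshold (s + 1) (d + 1)) m (m * 5 ^ w) := by
  induction s using Nat.strong_induction_on generalizing d w m with
  | _ s ihs =>
    match s with
    | 0 =>
      rw [heavyThreshold]
      exact (heavyBound_one m).mono le_rfl (Nat.le_mul_of_pos_right _ (by positivity))
    | 1 =>
      rw [heavyThreshold]
      exact (heavyBound_two m).mono le_rfl (Nat.le_mul_of_pos_right _ (by positivity))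
    | s + 2 =>
      have hs1 := fun d w m => ihs (s + 1) (by omega) d w m
      have hs2 := fun d w m => ihs s (by omega) d w m
      induction d generalizing w m with
      | zero =>
        induction w generalizing m with
        | zero =>
          refine HeavyBound.mono (HeavyBound.of_le ?_) le_rfl (Nat.zero_le _)
          have : 25 ≤ heavyThreshold (s + 2 + 1) (0 + 1) := heavyThreshold_ge s (0 + 1)
          simp only [ackHierarchy] at hm
          omega
        | succ w ihw =>
          simp only [ackHierarchy] at hm ihw hs1 hs2
          -- There are 25 layers and `Q₃ = 25`, so no symbol is heavy in the contracted sequence.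
          have hm' : m ≤ 25 * (2 * 5 ^ (2 * w)) := by
            refine hm.trans_eq ?_
            ring
          have := HeavyBound.step (s := s + 1) (Q₁ := heavyThreshold (s + 2) (0 + 1))
            (Q₂ := heavyThreshold (s + 1) (0 + 1)) (Q₃ := heavyThreshold (s + 3) 0)
            (F := 5 ^ w) (by omega) (by positivity) hm' ?_ ?_ ?_
            (HeavyBound.of_le (by simp [heavyThreshold]))
          · rw [show s + 2 + 1 = s + 3 from rfl, heavyThreshold]
            refine this.mono le_rfl ?_
            rw [add_zero, pow_succ']
            gcongr
            norm_num
          · intro k hk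
            have := ihw k hk
            rwa [show s + 2 + 1 = s + 3 from rfl, heavyThreshold] at this
          · exact fun k hk => hs1 0 w k hk
          · exact fun k hk => hs2 0 w k hk
      | succ d ihd =>
        induction w generalizing m with
        | zero =>
          refine HeavyBound.mono (HeavyBound.of_le ?_) le_rfl (Nat.zero_le _)
          have : 25 ≤ heavyThreshold (s + 2 + 1) (d + 1 + 1) := heavyThreshold_ge s (d + 1 + 1)
          simp only [ackHierarchy, Function.iterate_zero, id] at hm
          omega
        | succ w ihw =>
          set v := ackHierarchy (d + 1 + 1) w with hv
          have hrec : ackHierarchy (d + 1 + 1) (w + 1) = ackHierarchy (d + 1) v := by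
            simp only [hv, ackHierarchy, Function.iterate_succ_apply']
          rw [hrec] at hm
          set ℓ := 2 * 5 ^ v with hℓ
          have hℓpos : 0 < ℓ := by positivity
          rcases le_or_gt m ℓ with hml | hml
          · exact (ihw m hml).mono le_rfl (Nat.mul_le_mul_left _ (Nat.pow_le_pow_right
              (by norm_num) (by omega)))
          set q := m / ℓ + 1
          have hmq : m ≤ q * ℓ := by
            have := Nat.div_add_mod m ℓ
            have := Nat.mod_lt m hℓpos
            have : q * ℓ = ℓ * (m / ℓ) + ℓ := by ring
            omega
          -- The 2 in `ℓ` absorbs the rounding up in `q`, so the contracted sequence contributes at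
          -- most one symbol per original block.
          have hq : q * 5 ^ v ≤ m := by
            have h1 : m / ℓ * ℓ ≤ m := Nat.div_mul_le_self m ℓ
            have h2 : 1 ≤ m / ℓ := (Nat.one_le_div_iff hℓpos).2 hml.le
            calc q * 5 ^ v ≤ (m / ℓ + m / ℓ) * 5 ^ v := by gcongr; omega
              _ = m / ℓ * ℓ := by rw [hℓ]; ring
              _ ≤ m := h1
          have hqm : q ≤ 2 * 5 ^ ackHierarchy (d + 1) v :=
            (le_trans (Nat.le_mul_of_pos_right _ (by positivity)) hq).trans hm
          have := HeavyBound.step (s := s + 1) (Q₁ := heavyThreshold (s + 2) (d + 1 + 1))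
            (Q₂ := heavyThreshold (s + 1) (d + 1 + 1)) (Q₃ := heavyThreshold (s + 3) (d + 1))
            (F := 5 ^ w) (by omega) hℓpos hmq ?_ ?_ ?_ (ihd v q hqm)
          · rw [show s + 2 + 1 = s + 3 from rfl, heavyThreshold]
            refine this.mono le_rfl ?_
            have h5 : 1 ≤ 5 ^ w := Nat.one_le_pow _ _ (by norm_num)
            calc m * (4 * 5 ^ w) + q * 5 ^ v ≤ m * (4 * 5 ^ w) + m * 5 ^ w := by nlinarith
              _ = m * 5 ^ (w + 1) := by ring
          · intro k hk
            have := ihw k hk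
            rwa [show s + 2 + 1 = s + 3 from rfl, heavyThreshold] at this
          · exact fun k hk => hs1 (d + 1) w k hk
          · exact fun k hk => hs2 (d + 1) w k hk

/-! ### From heavy symbols to length. -/

/-- Split the occurrences of each symbol into consecutive groups of `Q + 1` and rename each group as
a new symbol. Full groups are heavy, so there are at most `N`; each old symbol adds at most one
incomplete group. -/
theorem card_le_of_heavyBound {s Q m N : ℕ} (hs : 1 ≤ s) (h : HeavyBound s Q m N) {X : Finset ℕ}
    {c β : ℕ → ℕ} (hβ : Monotone β) (hi : Set.InjOn (fun x => (c x, β x)) X)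
    (hm : (X.image β).card ≤ m) (ha : AltFree (s + 2) X c) :
    X.card ≤ (Q + 1) * ((X.image c).card + N) := by
  let T : ℕ → Finset ℕ := fun a => X.filter fun x => c x = a
  let c' : ℕ → ℕ := fun x => Nat.pair (c x) (rankIn (T (c x)) x / (Q + 1))
  have hclass : ∀ a i, (X.filter fun x => c' x = Nat.pair a i).card =
      ((Finset.range (T a).card).filter fun r => r / (Q + 1) = i).card := by
    intro a i
    rw [← card_rankIn_fiber (T a) fun r => r / (Q + 1) = i]
    congr 1
    ext x
    simp only [c', T, Finset.mem_filter, Nat.pair_eq_pair]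
    constructor
    · rintro ⟨hx, rfl, hr⟩
      exact ⟨⟨hx, rfl⟩, hr⟩
    · rintro ⟨⟨hx, rfl⟩, hr⟩
      exact ⟨hx, rfl, hr⟩
  have hi' : Set.InjOn (fun x => (c' x, β x)) X := by
    intro x hx y hy hxy
    simp only [c', Prod.mk.injEq, Nat.pair_eq_pair] at hxy
    exact hi hx hy (by simp [hxy.1.1, hxy.2])
  have ha' : AltFree (s + 2) X c' := by
    rintro a b g hab ⟨hg, hc⟩
    have hfst : ∀ i < s + 2, c (g i) = if i % 2 = 0 then a.unpair.1 else b.unpair.1 := by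
      intro i hi
      have := congrArg (fun r => (Nat.unpair r).1) (hc i hi).2
      simp only [c', Nat.unpair_pair] at this
      rw [this]
      split_ifs <;> rfl
    -- Groups of one old symbol follow each other in order, so they cannot form `a b a`.
    by_cases hab' : a.unpair.1 = b.unpair.1
    · simp only [hab', ite_self] at hfst
      have h0 := (hc 0 (by omega)).2
      have h1 := (hc 1 (by omega)).2
      have h2 := (hc 2 (by omega)).2
      have g01 : rankIn (T b.unpair.1) (g 0) ≤ rankIn (T b.unpair.1) (g 1) :=
        rankIn_mono _ (hg 0 (by omega)).le
      have g12 : rankIn (T b.unpair.1) (g 1) ≤ rankIn (T b.unpair.1) (g 2) :=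
        rankIn_mono _ (hg 1 (by omega)).le
      have g01 := Nat.div_le_div_right (c := Q + 1) g01
      have g12 := Nat.div_le_div_right (c := Q + 1) g12
      simp only [c', hfst 0 (by omega), hfst 1 (by omega), hfst 2 (by omega), Nat.zero_mod,
        if_true, Nat.one_mod, one_ne_zero, if_false, Nat.mod_self] at h0 h1 h2
      have e02 := (Nat.pair_eq_pair.1 (h0.trans h2.symm)).2
      apply hab
      exact h0.symm.trans ((Nat.pair_eq_pair.2 ⟨rfl, by omega⟩).trans h1)
    · exact ha _ _ g hab' ⟨hg, fun i hi => ⟨(hc i hi).1, hfst i hi⟩⟩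
  have hheavy := h X c' β hβ hi' hm ha'
  have hcolors : X.image c' ⊆ heavy Q X c' ∪
      (X.image c).image fun a => Nat.pair a ((T a).card / (Q + 1)) := by
    intro k hk
    obtain ⟨x, hx, rfl⟩ := Finset.mem_image.1 hk
    rw [Finset.mem_union]
    by_cases hlast : rankIn (T (c x)) x / (Q + 1) = (T (c x)).card / (Q + 1)
    · right
      refine Finset.mem_image.2 ⟨c x, Finset.mem_image_of_mem _ hx, ?_⟩
      simp only [c', hlast]
    · left
      rw [mem_heavy, hclass]
      set i := rankIn (T (c x)) x / (Q + 1)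
      have hle : i ≤ (T (c x)).card / (Q + 1) :=
        Nat.div_le_div_right (Finset.card_le_card (Finset.filter_subset _ _))
      have hlt : (i + 1) * (Q + 1) ≤ (T (c x)).card :=
        (Nat.le_div_iff_mul_le (by omega)).1 (by omega)
      calc Q < (Finset.Ico (i * (Q + 1)) ((i + 1) * (Q + 1))).card := by
            rw [Nat.card_Ico, ← Nat.sub_mul]; simp
        _ ≤ _ := Finset.card_le_card fun r hr => by
            simp only [Finset.mem_Ico, Finset.mem_filter, Finset.mem_range,
              Nat.div_eq_iff (show 0 < Q + 1 by omega)] at hr ⊢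
            have : (i + 1) * (Q + 1) = i * (Q + 1) + (Q + 1) := by ring
            omega
  have hncolors : (X.image c').card ≤ (X.image c).card + N := by
    refine (Finset.card_le_card hcolors).trans ((Finset.card_union_le _ _).trans ?_)
    rw [add_comm]
    exact add_le_add Finset.card_image_le hheavy
  calc X.card = ∑ k ∈ X.image c', (X.filter fun x => c' x = k).card :=
        Finset.card_eq_sum_card_image c' X
    _ ≤ ∑ _k ∈ X.image c', (Q + 1) := Finset.sum_le_sum fun k _ => by
        rw [← Nat.pair_unpair k, hclass]
        exact card_range_filter_div _ _ _ (Nat.succ_pos Q)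
    _ = (Q + 1) * (X.image c').card := by rw [Finset.sum_const, smul_eq_mul, mul_comm]
    _ ≤ _ := Nat.mul_le_mul_left _ hncolors

theorem AltFree.of_subsingleton {l : ℕ} (hl : 2 ≤ l) {X : Finset ℕ} {c : ℕ → ℕ}
    (h : ∀ x ∈ X, ∀ y ∈ X, x = y) : AltFree l X c := by
  rintro a b g - ⟨hg, hc⟩
  have := hg 0 (by omega)
  exact this.ne (h _ (hc 0 (by omega)).1 _ (hc 1 (by omega)).1)

/-! ### Greedy partition into segments of lower order. -/

/-- The greedy partition into maximal intervals without alternations of length `l`; an interval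
is labelled by its left end `σ z`. -/
theorem exists_greedy_partition {l : ℕ} (hl : 2 ≤ l) (X : Finset ℕ) (c : ℕ → ℕ) :
    ∃ σ : ℕ → ℕ, Monotone σ ∧ (∀ z, σ z ≤ z) ∧ (∀ z x, σ z ≤ x → x ≤ z → σ x = σ z) ∧
      (∀ z, AltFree l (X.filter fun x => σ z ≤ x ∧ x ≤ z) c) ∧
      ∀ z, σ (z + 1) ≠ σ z → ¬ AltFree l (X.filter fun x => σ z ≤ x ∧ x ≤ z + 1) c := by
  classical
  let next : ℕ → ℕ → ℕ := fun i v =>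
    if AltFree l (X.filter fun x => v ≤ x ∧ x ≤ i + 1) c then v else i + 1
  obtain ⟨σ, hzero, hnext⟩ : ∃ σ : ℕ → ℕ, σ 0 = 0 ∧ ∀ i, σ (i + 1) = next i (σ i) :=
    ⟨fun n => Nat.rec (motive := fun _ => ℕ) 0 next n, rfl, fun _ => rfl⟩
  have hsucc : ∀ i, σ (i + 1) =
      if AltFree l (X.filter fun x => σ i ≤ x ∧ x ≤ i + 1) c then σ i else i + 1 := hnext
  have hle : ∀ z, σ z ≤ z := by
    intro z
    induction z with
    | zero => exact hzero.le
    | succ i ih => rw [hsucc]; split_ifs <;> omega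
  have hmono : Monotone σ := by
    refine monotone_nat_of_le_succ fun i => ?_
    have := hle i
    rw [hsucc]
    split_ifs <;> omega
  have hidem : ∀ z, σ (σ z) = σ z := by
    intro z
    induction z with
    | zero => rw [hzero, hzero]
    | succ i ih =>
      by_cases h : AltFree l (X.filter fun x => σ i ≤ x ∧ x ≤ i + 1) c
      · rw [hsucc i, if_pos h, ih]
      · have : σ (i + 1) = i + 1 := by rw [hsucc, if_neg h]
        rw [this, this]
  refine ⟨σ, hmono, hle, fun z x h1 h2 => le_antisymm (hmono h2) (hidem z ▸ hmono h1),
    fun z => ?_, fun z hz h => hz ?_⟩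
  · rcases z with _ | i
    · refine AltFree.of_subsingleton hl fun x hx y hy => ?_
      simp only [Finset.mem_filter] at hx hy
      omega
    · by_cases h : AltFree l (X.filter fun x => σ i ≤ x ∧ x ≤ i + 1) c
      · rwa [hsucc i, if_pos h]
      · rw [hsucc i, if_neg h]
        refine AltFree.of_subsingleton hl fun x hx y hy => ?_
        simp only [Finset.mem_filter] at hx hy
        omega
  · rw [hsucc, if_pos h]

/-- The positions of `X` that carry the first occurrence of a symbol. -/
def firstOccurrences (X : Finset ℕ) (c : ℕ → ℕ) : Finset ℕ :=
  X.filter fun x => ∀ y ∈ X, c y = c x → x ≤ y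

/-- The positions of `X` that carry the last occurrence of a symbol. -/
def lastOccurrences (X : Finset ℕ) (c : ℕ → ℕ) : Finset ℕ :=
  X.filter fun x => ∀ y ∈ X, c y = c x → y ≤ x

theorem card_firstOccurrences_le (X : Finset ℕ) (c : ℕ → ℕ) :
    (firstOccurrences X c).card ≤ (X.image c).card := by
  refine Finset.card_le_card_of_injOn c
    (fun x hx => Finset.mem_coe.2 (Finset.mem_image_of_mem _ (Finset.mem_filter.1 hx).1))
    fun x hx y hy hxy => ?_
  have hx := Finset.mem_filter.1 hx
  have hy := Finset.mem_filter.1 hy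
  exact le_antisymm (hx.2 y hy.1 hxy.symm) (hy.2 x hx.1 hxy)

theorem card_lastOccurrences_le (X : Finset ℕ) (c : ℕ → ℕ) :
    (lastOccurrences X c).card ≤ (X.image c).card := by
  refine Finset.card_le_card_of_injOn c
    (fun x hx => Finset.mem_coe.2 (Finset.mem_image_of_mem _ (Finset.mem_filter.1 hx).1))
    fun x hx y hy hxy => ?_
  have hx := Finset.mem_filter.1 hx
  have hy := Finset.mem_filter.1 hy
  exact le_antisymm (hy.2 x hx.1 hxy) (hx.2 y hy.1 hxy.symm)

theorem exists_mem_firstOccurrences {X : Finset ℕ} (c : ℕ → ℕ) {x : ℕ} (hx : x ∈ X) :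
    ∃ y ∈ firstOccurrences X c, c y = c x ∧ y ≤ x := by
  have hne : (X.filter fun y => c y = c x).Nonempty := ⟨x, by simp [hx]⟩
  have hmem := Finset.mem_filter.1 ((X.filter fun y => c y = c x).min'_mem hne)
  refine ⟨_, Finset.mem_filter.2 ⟨hmem.1, fun y hy hyc => ?_⟩, hmem.2, ?_⟩
  · exact Finset.min'_le _ _ (by simp [hy, hyc.trans hmem.2])
  · exact Finset.min'_le _ _ (by simp [hx])

theorem exists_mem_lastOccurrences {X : Finset ℕ} (c : ℕ → ℕ) {x : ℕ} (hx : x ∈ X) :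
    ∃ y ∈ lastOccurrences X c, c y = c x ∧ x ≤ y := by
  have hne : (X.filter fun y => c y = c x).Nonempty := ⟨x, by simp [hx]⟩
  have hmem := Finset.mem_filter.1 ((X.filter fun y => c y = c x).max'_mem hne)
  refine ⟨_, Finset.mem_filter.2 ⟨hmem.1, fun y hy hyc => ?_⟩, hmem.2, ?_⟩
  · exact Finset.le_max' _ _ (by simp [hy, hyc.trans hmem.2])
  · exact Finset.le_max' _ _ (by simp [hx])

theorem IsAlternation.lt {l : ℕ} {X : Finset ℕ} {c : ℕ → ℕ} {a b : ℕ} {g : ℕ → ℕ}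
    (h : IsAlternation l X c a b g) {i j : ℕ} (hij : i < j) (hj : j < l) : g i < g j := by
  induction j, hij using Nat.le_induction with
  | base => exact h.1 i hj
  | succ j hij ih => exact (ih (by omega)).trans (h.1 j hj)

/-- Every segment contains a first or a last occurrence of some symbol. Otherwise the alternation of
length `s` that closes the segment extends by one term on each side to the forbidden length `s + 2`.
-/
theorem card_greedy_partition_le {s p q : ℕ} (hs : 3 ≤ s) {c σ : ℕ → ℕ}
    (ha : AltFree (s + 2) (Finset.Ico p q) c)
    (hσ : ∀ z x, σ z ≤ x → x ≤ z → σ x = σ z)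
    (hfree : ∀ z, AltFree s ((Finset.Ico p q).filter fun x => σ z ≤ x ∧ x ≤ z) c)
    (hmax : ∀ z, σ (z + 1) ≠ σ z →
      ¬ AltFree s ((Finset.Ico p q).filter fun x => σ z ≤ x ∧ x ≤ z + 1) c) :
    ((Finset.Ico p q).image σ).card ≤ 2 * ((Finset.Ico p q).image c).card := by
  set X := Finset.Ico p q with hX
  have hsub : X.image σ ⊆ (firstOccurrences X c ∪ lastOccurrences X c).image σ := by
    intro v hv
    obtain ⟨x, hx, rfl⟩ := Finset.mem_image.1 hv
    by_contra hno
    have hF : ∀ y ∈ firstOccurrences X c, σ y ≠ σ x := fun y hy h =>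
      hno (Finset.mem_image.2 ⟨y, Finset.mem_union_left _ hy, h⟩)
    have hG : ∀ y ∈ lastOccurrences X c, σ y ≠ σ x := fun y hy h =>
      hno (Finset.mem_image.2 ⟨y, Finset.mem_union_right _ hy, h⟩)
    have hne : (X.filter fun y => σ y = σ x).Nonempty := ⟨x, by simp [hx]⟩
    obtain ⟨z, hz, hzmax⟩ : ∃ z ∈ X.filter fun y => σ y = σ x,
        ∀ y ∈ X.filter (fun y => σ y = σ x), y ≤ z :=
      ⟨_, Finset.max'_mem _ hne, fun y hy => Finset.le_max' _ y hy⟩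
    obtain ⟨hzX, hzx⟩ := Finset.mem_filter.1 hz
    rw [← hzx] at hF hG
    have hz1 : z + 1 ∈ X := by
      by_contra hz1
      refine hG z (Finset.mem_filter.2 ⟨hzX, fun y hy _ => ?_⟩) rfl
      simp only [hX, Finset.mem_Ico] at hz1 hzX hy
      omega
    have hσz : σ (z + 1) ≠ σ z := fun h => by
      have := hzmax (z + 1) (Finset.mem_filter.2 ⟨hz1, h.trans hzx⟩)
      omega
    have halt := hmax z hσz
    simp only [AltFree, not_forall, not_not] at halt
    obtain ⟨a, b, g, hab, hg⟩ := halt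
    have hmem : ∀ i < s, g i ∈ X ∧ σ z ≤ g i ∧ g i ≤ z + 1 := fun i hi =>
      Finset.mem_filter.1 (hg.2 i hi).1
    -- The alternation must use the new position, since the segment itself has none.
    have hend : g (s - 1) = z + 1 := by
      by_contra hend
      have h1 := hmem (s - 1) (by omega)
      refine hfree z a b g hab ⟨hg.1, fun i hi => ⟨Finset.mem_filter.2 ⟨(hmem i hi).1,
        (hmem i hi).2.1, ?_⟩, (hg.2 i hi).2⟩⟩
      rcases Nat.lt_or_ge i (s - 1) with h | h
      · have := hg.lt h (by omega)
        omega
      · obtain rfl : i = s - 1 := by omega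
        omega
    obtain ⟨y, hyF, hcy, hy⟩ := exists_mem_firstOccurrences c (hmem 1 (by omega)).1
    obtain ⟨w, hwG, hcw, hw⟩ := exists_mem_lastOccurrences c (hmem (s - 2) (by omega)).1
    have hyg : y < g 0 := by
      have h1 := hg.lt (show 1 < s - 1 by omega) (by omega)
      have h0 := hmem 0 (by omega)
      by_contra hcon
      exact hF y hyF (hσ z y (by omega) (by omega))
    -- The symbol at index `s - 2` differs from the one at `z + 1`, so its last occurrence, being
    -- outside the segment, lies strictly beyond `z + 1`.
    have hne' : c w ≠ c (z + 1) := by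
      rw [hcw, ← hend, (hg.2 (s - 2) (by omega)).2, (hg.2 (s - 1) (by omega)).2]
      rcases Nat.mod_two_eq_zero_or_one s with h | h
      · rw [if_pos (by omega), if_neg (by omega)]; exact hab
      · rw [if_neg (by omega), if_pos (by omega)]; exact hab.symm
    have hwz : z + 1 < w := by
      have h0 := hmem (s - 2) (by omega)
      have h1 : w ≠ z + 1 := fun h => hne' (by rw [h])
      by_contra hcon
      exact hG w hwG (hσ z w (by omega) (by omega))
    refine ha b a (fun i => if i = 0 then y else if i ≤ s then g (i - 1) else w) hab.symm
      ⟨fun i hi => ?_, fun i hi => ?_⟩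
    · rcases i with _ | i
      · simpa [show 1 ≤ s by omega] using hyg
      · by_cases h : i + 2 ≤ s
        · simpa [h, show i + 1 ≤ s by omega] using hg.1 i (by omega)
        · obtain rfl : i = s - 1 := by omega
          simpa [h, show s - 1 + 1 ≤ s by omega, hend] using hwz
    · rcases i with _ | i
      · simpa [(Finset.mem_filter.1 hyF).1, hcy] using (hg.2 1 (by omega)).2
      · by_cases h : i + 1 ≤ s
        · have := (hg.2 i (by omega)).2
          simp only [Nat.add_eq_zero_iff, one_ne_zero, and_false, if_false, h, if_true,
            Nat.add_sub_cancel, (hmem i (by omega)).1, this, true_and]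
          rcases Nat.mod_two_eq_zero_or_one i with h | h <;> simp [h, Nat.add_mod]
        · obtain rfl : i = s := by omega
          have := (hg.2 (i - 2) (by omega)).2
          simp only [Nat.add_eq_zero_iff, one_ne_zero, and_false, if_false, h,
            (Finset.mem_filter.1 hwG).1, hcw, this, true_and]
          rcases Nat.mod_two_eq_zero_or_one i with h | h
          · rw [if_pos (by omega), if_neg (by omega)]
          · rw [if_neg (by omega), if_pos (by omega)]
  have h1 := card_firstOccurrences_le X c
  have h2 := card_lastOccurrences_le X c
  have h3 := Finset.card_union_le (firstOccurrences X c) (lastOccurrences X c)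
  have h4 := (Finset.card_le_card hsub).trans Finset.card_image_le
  omega

/-- Each position is a last occurrence or is directly followed by a first occurrence; otherwise its
symbol and the next one form an alternation of length 4. -/
theorem card_le_of_altFree_four {p q : ℕ} {c : ℕ → ℕ} (hadj : ∀ i, p ≤ i → i + 1 < q → c i ≠ c (i + 1))
    (ha : AltFree 4 (Finset.Ico p q) c) :
    (Finset.Ico p q).card ≤ ((Finset.Ico p q).image c).card * 2 := by
  set X := Finset.Ico p q with hX
  have hsub : X ⊆ lastOccurrences X c ∪ (firstOccurrences X c).image fun x => x - 1 := by
    intro i hi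
    by_contra hno
    simp only [Finset.mem_union, Finset.mem_image, not_or, not_exists, not_and, lastOccurrences,
      Finset.mem_filter, hi, true_and, not_forall, not_le] at hno
    obtain ⟨⟨y, hy, hcy, hiy⟩, hno⟩ := hno
    have hi' := Finset.mem_Ico.1 hi
    have hy' := Finset.mem_Ico.1 hy
    have hne := hadj i hi'.1 (by omega)
    have hi1 : i + 1 ∈ X := Finset.mem_Ico.2 ⟨by omega, by omega⟩
    obtain ⟨w, hw, hcw, hwi⟩ := exists_mem_firstOccurrences c hi1
    have hw1 : w ≠ i + 1 := fun h => hno w hw (by omega)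
    have hw2 : w ≠ i := fun h => hne (by rw [← hcw, h])
    have hy2 : y ≠ i + 1 := fun h => hne (by rw [← hcy, h])
    exact ha.false_of_four (Finset.mem_filter.1 hw).1 hi hi1 hy (by omega) (by omega) (by omega)
      hcw hcy.symm (by rw [hcw]; exact hne.symm)
  have h1 := card_firstOccurrences_le X c
  have h2 := card_lastOccurrences_le X c
  have h3 := (Finset.card_le_card hsub).trans (Finset.card_union_le _ _)
  have h4 := Finset.card_image_le (s := firstOccurrences X c) (f := fun x => x - 1)
  omega

/-! ### Length bound for every order. -/

/-- Coefficients `Φ` such that sequences of order `s` on `n` symbols have length at most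
`n * Φ s (invAck n)`. -/
def lengthFactor : ℕ → ℕ → ℕ
  | 0, _ => 2
  | 1, _ => 2
  | 2, _ => 2
  | s + 3, d => lengthFactor (s + 1) d * ((heavyThreshold (s + 3) d + 1) * 251)

theorem lengthFactor_mono (s : ℕ) : Monotone (lengthFactor s) := by
  induction s using Nat.strong_induction_on with
  | _ s ih =>
    match s with
    | 0 => exact monotone_const
    | 1 => exact monotone_const
    | 2 => exact monotone_const
    | s + 3 =>
      intro d e h
      rw [lengthFactor, lengthFactor]
      have := ih (s + 1) (by omega) h
      have := heavyThreshold_mono (s + 3) h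
      gcongr

theorem invAck_mono : Monotone invAck := fun x y h =>
  (isLeast_invAck x).2 ⟨(isLeast_invAck y).1.1, h.trans (isLeast_invAck y).1.2⟩

theorem card_le_mul_lengthFactor (s : ℕ) {p q : ℕ} {c : ℕ → ℕ}
    (hadj : ∀ i, p ≤ i → i + 1 < q → c i ≠ c (i + 1)) (ha : AltFree (s + 2) (Finset.Ico p q) c) :
    (Finset.Ico p q).card ≤ ((Finset.Ico p q).image c).card *
      lengthFactor s (invAck ((Finset.Ico p q).image c).card) := by
  induction s using Nat.strong_induction_on generalizing p q with
  | _ s ih =>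
    match s with
    | 0 => exact card_le_of_altFree_four hadj (ha.mono (by omega))
    | 1 => exact card_le_of_altFree_four hadj (ha.mono (by omega))
    | 2 => exact card_le_of_altFree_four hadj ha
    | s + 3 =>
      set X := Finset.Ico p q with hX
      set n := (X.image c).card with hn
      obtain ⟨σ, hmono, hle, hσ, hfree, hmax⟩ :=
        exists_greedy_partition (l := s + 3) (by omega) X c
      have hseg : ∀ v ∈ X.image σ, (X.filter fun x => σ x = v).card ≤
          ((X.filter fun x => σ x = v).image c).card * lengthFactor (s + 1) (invAck n) := by
        intro v hv
        obtain ⟨x, hx, rfl⟩ := Finset.mem_image.1 hv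
        have hne : (X.filter fun y => σ y = σ x).Nonempty := ⟨x, by simp [hx]⟩
        obtain ⟨z, hz, hzmax⟩ : ∃ z ∈ X.filter fun y => σ y = σ x,
            ∀ y ∈ X.filter (fun y => σ y = σ x), y ≤ z :=
          ⟨_, Finset.max'_mem _ hne, fun y hy => Finset.le_max' _ y hy⟩
        obtain ⟨hzX, hzx⟩ := Finset.mem_filter.1 hz
        have heq : (X.filter fun y => σ y = σ x) = X.filter fun y => σ z ≤ y ∧ y ≤ z := by
          refine Finset.filter_congr fun y hy => ⟨fun h => ⟨?_, ?_⟩, fun h => ?_⟩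
          · rw [hzx, ← h]; exact hle y
          · exact hzmax y (Finset.mem_filter.2 ⟨hy, h⟩)
          · rw [hσ z y h.1 h.2, hzx]
        have hIco : (X.filter fun y => σ y = σ x) = Finset.Ico (max p (σ z)) (z + 1) := by
          rw [heq]
          ext y
          have := Finset.mem_Ico.1 hzX
          simp only [hX, Finset.mem_filter, Finset.mem_Ico]
          omega
        have hzq := Finset.mem_Ico.1 hzX
        have := ih (s + 1) (by omega) (p := max p (σ z)) (q := z + 1)
          (fun i h1 h2 => hadj i (by omega) (by omega)) (hIco ▸ heq ▸ hfree z)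
        rw [← hIco] at this
        refine this.trans (Nat.mul_le_mul_left _ (lengthFactor_mono _ (invAck_mono ?_)))
        exact Finset.card_le_card (Finset.image_subset_image (Finset.filter_subset _ _))
      -- One representative per symbol and segment; its size is the sum over segments of the numbers
      -- of distinct symbols.
      obtain ⟨X', hX', hinj', himg'⟩ := Finset.exists_subset_injOn_image_eq_of_surjOn (X : Set ℕ)
        (X.image fun x => (c x, σ x)) (by rw [Finset.coe_image]; exact Set.surjOn_image _ _)
      rw [Finset.coe_subset] at hX'
      have hcard' : ∑ v ∈ X.image σ, ((X.filter fun x => σ x = v).image c).card ≤ X'.card := by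
        rw [← Finset.card_image_of_injOn hinj', himg',
          Finset.card_eq_sum_card_fiberwise (f := Prod.snd) (t := X.image σ)]
        · refine Finset.sum_le_sum fun v _ => Finset.card_le_card_of_injOn (fun a => (a, v)) ?_ ?_
          · intro a ha
            obtain ⟨x, hx, rfl⟩ := Finset.mem_image.1 (Finset.mem_coe.1 ha)
            have hx := Finset.mem_filter.1 hx
            exact Finset.mem_coe.2 (Finset.mem_filter.2
              ⟨Finset.mem_image.2 ⟨x, hx.1, by rw [hx.2]⟩, rfl⟩)
          · intro a _ b _ h
            exact (Prod.mk.inj h).1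
        · intro u hu
          obtain ⟨x, hx, rfl⟩ := Finset.mem_image.1 (Finset.mem_coe.1 hu)
          exact Finset.mem_coe.2 (Finset.mem_image_of_mem _ hx)
      have hblocks : (X'.image σ).card ≤ 2 * n :=
        (Finset.card_le_card (Finset.image_subset_image hX')).trans
          (card_greedy_partition_le (by omega) ha hσ hfree hmax)
      obtain ⟨d, hd⟩ : ∃ d, invAck n = d + 1 :=
        Nat.exists_eq_succ_of_ne_zero (by have := (isLeast_invAck n).1.1; omega)
      have hnd : n ≤ ackHierarchy (d + 1) 3 := hd ▸ (isLeast_invAck n).1.2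
      -- The argument 3 is the one in the definition of `ackFun`. The resulting count is `250 * n`,
      -- and the `n` symbols themselves make 251.
      have hbound := heavyBound_of_le_ackHierarchy (s + 2) d 3 (2 * n)
        (Nat.mul_le_mul_left _ (hnd.trans (Nat.lt_pow_self (by norm_num)).le))
      have hX'card := card_le_of_heavyBound (by omega) hbound hmono hinj' hblocks (ha.subset hX')
      have hX'n : (X'.image c).card ≤ n := Finset.card_le_card (Finset.image_subset_image hX')
      rw [lengthFactor]
      calc X.card = ∑ v ∈ X.image σ, (X.filter fun x => σ x = v).card :=
            Finset.card_eq_sum_card_image σ X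
        _ ≤ ∑ v ∈ X.image σ, ((X.filter fun x => σ x = v).image c).card *
              lengthFactor (s + 1) (invAck n) := Finset.sum_le_sum hseg
        _ ≤ X'.card * lengthFactor (s + 1) (invAck n) := by
            rw [← Finset.sum_mul]; exact Nat.mul_le_mul_right _ hcard'
        _ ≤ ((heavyThreshold (s + 3) (invAck n) + 1) * (n + 2 * n * 5 ^ 3)) *
              lengthFactor (s + 1) (invAck n) := by
            refine Nat.mul_le_mul_right _ (hX'card.trans ?_)
            rw [hd]
            exact Nat.mul_le_mul_left _ (Nat.add_le_add_right hX'n _)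
        _ = _ := by ring

theorem dsLambda_le (s n : ℕ) (hs : 1 ≤ s) : dsLambda s n ≤ n * lengthFactor s (invAck n) := by
  obtain ⟨S, ⟨hsp, hfree⟩, hn, hlen⟩ := (isGreatest_dsLambda s n hs).1
  rw [← hlen]
  set c : ℕ → ℕ := fun i => S.getD i 0
  have himg : (Finset.Ico 0 S.length).image c = S.toFinset := by
    ext a
    simp only [c, Finset.mem_image, Finset.mem_Ico, List.mem_toFinset, List.mem_iff_getElem]
    constructor
    · rintro ⟨i, ⟨-, hi⟩, rfl⟩
      exact ⟨i, hi, (List.getD_eq_getElem _ _ hi).symm⟩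
    · rintro ⟨i, hi, rfl⟩
      exact ⟨i, ⟨Nat.zero_le _, hi⟩, List.getD_eq_getElem _ _ hi⟩
  have hadj : ∀ i, 0 ≤ i → i + 1 < S.length → c i ≠ c (i + 1) := by
    intro i _ hi
    have := hsp ⟨i, by omega⟩ ⟨i + 1, hi⟩ (by simp) (by simp)
    change S.getD i 0 ≠ S.getD (i + 1) 0
    rwa [List.getD_eq_getElem _ _ hi, List.getD_eq_getElem _ _ (show i < S.length by omega)]
  have ha : AltFree (s + 2) (Finset.Ico 0 S.length) c := by
    intro a b g hab hg
    apply hfree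
    have hlt : ∀ i < s + 2, g i < S.length := fun i hi => (Finset.mem_Ico.1 (hg.2 i hi).1).2
    refine ⟨fun x => if x = 0 then a else b, ?_, ?_⟩
    · intro x hx y hy hxy
      simp only [alternation, Set.mem_ofPred_eq, List.mem_map, List.mem_range] at hx hy
      obtain ⟨i, -, rfl⟩ := hx
      obtain ⟨j, -, rfl⟩ := hy
      rcases Nat.mod_two_eq_zero_or_one i with h | h <;>
        rcases Nat.mod_two_eq_zero_or_one j with h' | h' <;>
        simp_all
    · have hl : ((alternation (s + 2)).map fun x => if x = 0 then a else b).length = s + 2 := by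
        simp [alternation]
      rw [List.sublist_iff_exists_fin_orderEmbedding_get_eq]
      refine ⟨OrderEmbedding.ofStrictMono
        (fun j => ⟨g j.val, hlt _ (by have := j.isLt; omega)⟩) ?_, ?_⟩
      · intro j k hjk
        exact hg.lt hjk (by have := k.isLt; omega)
      · intro j
        have hj : j.val < s + 2 := by have := j.isLt; omega
        have := (hg.2 j.val hj).2
        simp only [c, List.getD_eq_getElem _ _ (hlt _ hj)] at this
        change _ = S[g j.val]'(hlt _ hj)
        rw [this, List.get_eq_getElem, List.getElem_map]
        simp only [alternation, List.getElem_map, List.getElem_range]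
  have := card_le_mul_lengthFactor s hadj ha
  rwa [himg, hn, Nat.card_Ico, Nat.sub_zero] at this

/-! ### Growth of the thresholds. -/

theorem heavyThreshold_one (d : ℕ) : heavyThreshold 1 d = 1 := by simp [heavyThreshold]

theorem heavyThreshold_two (d : ℕ) : heavyThreshold 2 d = 2 := by simp [heavyThreshold]

theorem heavyThreshold_three (d : ℕ) : heavyThreshold 3 d = 25 + 4 * d := by
  induction d with
  | zero => simp [heavyThreshold]
  | succ d ih =>
    rw [heavyThreshold, ih, heavyThreshold_one, heavyThreshold_two]
    ring

/-- The affine term makes the recursion homogeneous: the left side exactly doubles with `d` and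
starts at 91. -/
theorem heavyThreshold_four_le (d : ℕ) : heavyThreshold 4 d + 8 * d + 66 ≤ 91 * 2 ^ d := by
  induction d with
  | zero => simp [heavyThreshold]
  | succ d ih =>
    have h : heavyThreshold 4 (d + 1) = 2 * (25 + 4 * (d + 1)) + 2 * heavyThreshold 4 d := by
      rw [heavyThreshold, heavyThreshold_three, heavyThreshold_two]
    rw [h, pow_succ]
    omega

theorem heavyThreshold_le_succ (s d : ℕ) : heavyThreshold (s + 1) d ≤ heavyThreshold (s + 2) d := by
  match s, d with
  | 0, _ => simp [heavyThreshold]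
  | 1, d =>
    rw [heavyThreshold_two]
    exact le_trans (by norm_num) (heavyThreshold_ge 0 d)
  | s + 2, 0 => simp [heavyThreshold]
  | s + 2, d + 1 =>
    rw [heavyThreshold.eq_5 (s + 1)]
    change heavyThreshold (s + 3) (d + 1) ≤ 2 * heavyThreshold (s + 3) (d + 1) + _
    omega

/-- Unfolding the recursion at two consecutive orders gives a factor 5; the power of two 8 costs 3
in the exponent. -/
theorem heavyThreshold_succ_le (s d : ℕ) : heavyThreshold (s + 5) (d + 1) ≤
    8 * heavyThreshold (s + 3) (d + 1) * heavyThreshold (s + 5) d := by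
  have h : heavyThreshold (s + 4) (d + 1) ≤
      2 * heavyThreshold (s + 3) (d + 1) * heavyThreshold (s + 5) d := by
    rw [heavyThreshold]
    have h1 := heavyThreshold_le_succ (s + 1) (d + 1)
    have h2 := heavyThreshold_le_succ (s + 3) d
    have h3 := heavyThreshold_ge (s + 2) d
    have := Nat.mul_le_mul h1 h2
    have := Nat.mul_le_mul_left (heavyThreshold (s + 3) (d + 1)) h3
    simp only [show s + 2 + 3 = s + 5 from rfl, show s + 1 + 2 = s + 3 from rfl,
      show s + 1 + 1 = s + 2 from rfl,
      show s + 3 + 1 = s + 4 from rfl] at *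
    nlinarith
  rw [heavyThreshold]
  simp only [show s + 2 + 2 = s + 4 from rfl, show s + 2 + 1 = s + 3 from rfl,
    show s + 2 + 3 = s + 5 from rfl]
  nlinarith

theorem add_one_pow_sub_pow_ge (x : ℝ) (hx : 0 ≤ x) (k : ℕ) :
    (x + 1) ^ k ≤ (x + 1) ^ (k + 1) - x ^ (k + 1) := by
  have : x ^ k ≤ (x + 1) ^ k := by gcongr; linarith
  have := mul_le_mul_of_nonneg_left this hx
  rw [pow_succ, pow_succ]
  linarith

/-- Bernoulli-type step that telescopes the sum of `x ^ k / k!` into `x ^ (k + 1) / (k + 1)!`. -/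
theorem pow_div_factorial_add_le (x : ℝ) (hx : 0 ≤ x) (k : ℕ) :
    1 / (Nat.factorial (k + 1) : ℝ) * x ^ (k + 1) + 1 / (Nat.factorial k : ℝ) * x ^ k ≤
      1 / (Nat.factorial (k + 1) : ℝ) * (x + 1) ^ (k + 1) := by
  have h : x ^ (k + 1) + (k + 1) * x ^ k ≤ (x + 1) ^ (k + 1) := by
    induction k with
    | zero => simp
    | succ k ih =>
      have := mul_le_mul_of_nonneg_right ih (show (0 : ℝ) ≤ x + 1 by linarith)
      have h0 : 0 ≤ (k + 1) * x ^ k := by positivity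
      rw [pow_succ (x + 1)]
      refine le_trans ?_ this
      push_cast
      ring_nf at h0 ⊢
      linarith
  have hk : (Nat.factorial (k + 1) : ℝ) = (k + 1) * Nat.factorial k := by
    rw [Nat.factorial_succ]; push_cast; ring
  have hpos : (0 : ℝ) < Nat.factorial k := by positivity
  have heq : 1 / (Nat.factorial k : ℝ) = 1 / (Nat.factorial (k + 1) : ℝ) * (k + 1) := by
    rw [hk]; field_simp
  rw [heq, mul_assoc, ← mul_add]
  gcongr

theorem add_one_pow_sub_pow_mul_le (x : ℝ) (hx : 0 ≤ x) (k : ℕ) :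
    ((x + 1) ^ k - x ^ k) * (x + 1) ≤ k * (x + 1) ^ k := by
  induction k with
  | zero => simp
  | succ k ih =>
    have h1 := mul_le_mul_of_nonneg_left ih hx
    have h2 : 0 ≤ (k : ℝ) * (x + 1) ^ k := by positivity
    push_cast
    rw [pow_succ, pow_succ]
    nlinarith

theorem one_div_factorial_le_one (k : ℕ) : 1 / (Nat.factorial k : ℝ) ≤ 1 := by
  rw [div_le_one (by positivity)]
  exact_mod_cast Nat.succ_le_of_lt (Nat.factorial_pos k)

theorem natCast_le_two_rpow (n : ℕ) : (n : ℝ) ≤ 2 ^ (n : ℝ) := by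
  rw [Real.rpow_natCast]
  exact_mod_cast (Nat.lt_two_pow_self).le

theorem eight_mul_mul_le_two_rpow {a b p q r : ℝ} (hb : 0 ≤ b) (hap : a ≤ 2 ^ p)
    (hbq : b ≤ 2 ^ q) (hr : 3 + p + q ≤ r) : 8 * a * b ≤ 2 ^ r := by
  calc 8 * a * b ≤ 8 * 2 ^ p * 2 ^ q := by gcongr
    _ = 2 ^ (3 + p + q) := by
        rw [Real.rpow_add two_pos, Real.rpow_add two_pos]
        norm_num
    _ ≤ 2 ^ r := Real.rpow_le_rpow_of_exponent_le one_le_two hr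

theorem logb_two_le_self {x : ℝ} (hx : 0 < x) : Real.logb 2 x ≤ x := by
  rw [Real.logb_le_iff_le_rpow one_lt_two hx]
  have h := one_add_mul_self_le_rpow_one_add (s := 1) (p := max x 1) (by norm_num) (le_max_right _ _)
  rcases le_total 1 x with h1 | h1
  · rw [max_eq_left h1] at h
    norm_num at h
    linarith
  · exact h1.trans (Real.one_le_rpow one_le_two hx.le)

theorem heavyThreshold_even_le (k : ℕ) : ∃ C : ℝ, 0 ≤ C ∧ ∀ e : ℕ,
    (heavyThreshold (2 * k + 4) (e + 1) : ℝ) ≤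
      2 ^ (1 / (Nat.factorial (k + 1) : ℝ) * ((e + 1 : ℕ) : ℝ) ^ (k + 1)
        + C * ((e + 1 : ℕ) : ℝ) ^ k) := by
  induction k with
  | zero =>
    refine ⟨7, by norm_num, fun e => ?_⟩
    have h : heavyThreshold 4 (e + 1) ≤ 2 ^ (e + 1 + 7) := by
      have := heavyThreshold_four_le (e + 1)
      rw [pow_add]
      omega
    have : (1 / (Nat.factorial (0 + 1) : ℝ) * ((e + 1 : ℕ) : ℝ) ^ (0 + 1)
        + 7 * ((e + 1 : ℕ) : ℝ) ^ 0) = ((e + 1 + 7 : ℕ) : ℝ) := by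
      push_cast; norm_num
    rw [this, Real.rpow_natCast]
    exact_mod_cast h
  | succ k ih =>
    obtain ⟨C, hC, hle⟩ := ih
    set T : ℝ := (heavyThreshold (2 * (k + 1) + 4) (0 + 1) : ℝ) with hT
    have hT0 : 0 ≤ T := Nat.cast_nonneg _
    -- In the constant, 3 pays for the factor 8, 1 for replacing `(x + 1) ^ (k + 1)` by `x ^ (k +
    -- 1)` in the leading term, and `T` for the start of the induction.
    refine ⟨C + 4 + T, by positivity, fun e => ?_⟩
    induction e with
    | zero =>
      refine (natCast_le_two_rpow _).trans (Real.rpow_le_rpow_of_exponent_le one_le_two ?_)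
      have : 0 ≤ 1 / (Nat.factorial (k + 1 + 1) : ℝ) := by positivity
      rw [← hT, zero_add, Nat.cast_one, one_pow, one_pow]
      linarith
    | succ e ihe =>
      have hrec : (heavyThreshold (2 * (k + 1) + 4) (e + 1 + 1) : ℝ) ≤
          8 * heavyThreshold (2 * k + 4) (e + 1 + 1) * heavyThreshold (2 * (k + 1) + 4) (e + 1) := by
        exact_mod_cast heavyThreshold_succ_le (2 * k + 1) (e + 1)
      refine hrec.trans (eight_mul_mul_le_two_rpow (Nat.cast_nonneg _)
        (hle (e + 1)) ihe ?_)
      have hx : (0 : ℝ) ≤ ((e + 1 : ℕ) : ℝ) := Nat.cast_nonneg _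
      rw [Nat.cast_succ (e + 1)]
      set x : ℝ := ((e + 1 : ℕ) : ℝ)
      have hA := pow_div_factorial_add_le x hx (k + 1)
      have hB := add_one_pow_sub_pow_ge x hx k
      have hone : (1 : ℝ) ≤ (x + 1) ^ k := one_le_pow₀ (by linarith)
      set D := (x + 1) ^ (k + 1) - x ^ (k + 1) with hD
      have hF : 1 / (Nat.factorial (k + 1) : ℝ) * D ≤ D :=
        mul_le_of_le_one_left (by linarith) (one_div_factorial_le_one _)
      have hCD := mul_le_mul_of_nonneg_left hB hC
      have hTD : 0 ≤ T * D := mul_nonneg hT0 (by linarith)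
      have hxD : (x + 1) ^ (k + 1) = D + x ^ (k + 1) := by rw [hD]; ring
      rw [hxD]
      linarith

theorem heavyThreshold_odd_le (k : ℕ) : ∃ C : ℝ, 0 ≤ C ∧ ∀ e : ℕ,
    (heavyThreshold (2 * k + 3) (e + 1) : ℝ) ≤
      2 ^ (1 / (Nat.factorial k : ℝ) * ((e + 1 : ℕ) : ℝ) ^ k * Real.logb 2 ((e + 1 : ℕ) : ℝ)
        + C * ((e + 1 : ℕ) : ℝ) ^ k) := by
  induction k with
  | zero =>
    refine ⟨5, by norm_num, fun e => ?_⟩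
    have hpos : (0 : ℝ) < ((e + 1 : ℕ) : ℝ) := by positivity
    have h : (heavyThreshold 3 (e + 1) : ℝ) ≤ ((e + 1 : ℕ) : ℝ) * 32 := by
      rw [heavyThreshold_three]
      exact_mod_cast (by omega)
    refine h.trans_eq ?_
    rw [Real.rpow_add two_pos, pow_zero, Nat.factorial_zero, Nat.cast_one, div_one, mul_one,
      one_mul, Real.rpow_logb two_pos (by norm_num) hpos]
    norm_num
  | succ k ih =>
    obtain ⟨C, hC, hle⟩ := ih
    set T : ℝ := (heavyThreshold (2 * (k + 1) + 3) (0 + 1) : ℝ) with hT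
    have hT0 : 0 ≤ T := Nat.cast_nonneg _
    -- Here `k` pays for replacing `(x + 1) ^ k` by `x ^ k` in the logarithmic term, using `logb 2
    -- (x + 1) ≤ x + 1`.
    refine ⟨C + 3 + k + T, by positivity, fun e => ?_⟩
    induction e with
    | zero =>
      refine (natCast_le_two_rpow _).trans (Real.rpow_le_rpow_of_exponent_le one_le_two ?_)
      rw [← hT]
      norm_num
      have : (0 : ℝ) ≤ k := Nat.cast_nonneg _
      linarith
    | succ e ihe =>
      have hrec : (heavyThreshold (2 * (k + 1) + 3) (e + 1 + 1) : ℝ) ≤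
          8 * heavyThreshold (2 * k + 3) (e + 1 + 1) * heavyThreshold (2 * (k + 1) + 3) (e + 1) := by
        exact_mod_cast heavyThreshold_succ_le (2 * k) (e + 1)
      refine hrec.trans (eight_mul_mul_le_two_rpow (Nat.cast_nonneg _)
        (hle (e + 1)) ihe ?_)
      have hx : (1 : ℝ) ≤ ((e + 1 : ℕ) : ℝ) := by push_cast; linarith [Nat.cast_nonneg (α := ℝ) e]
      rw [Nat.cast_succ (e + 1)]
      set x : ℝ := ((e + 1 : ℕ) : ℝ)
      have hx0 : 0 ≤ x := by linarith
      have hlog : Real.logb 2 x ≤ Real.logb 2 (x + 1) :=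
        Real.logb_le_logb_of_le one_lt_two (by linarith) (by linarith)
      have hL : Real.logb 2 (x + 1) ≤ x + 1 := logb_two_le_self (by linarith)
      have hL0 : 0 ≤ Real.logb 2 (x + 1) := Real.logb_nonneg one_lt_two (by linarith)
      set L := Real.logb 2 (x + 1)
      have hA := mul_le_mul_of_nonneg_right (pow_div_factorial_add_le x hx0 k) hL0
      have hB := add_one_pow_sub_pow_ge x hx0 k
      have hone : (1 : ℝ) ≤ (x + 1) ^ k := one_le_pow₀ (by linarith)
      have hM : 1 / (Nat.factorial (k + 1) : ℝ) * x ^ (k + 1) * Real.logb 2 x ≤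
          1 / (Nat.factorial (k + 1) : ℝ) * x ^ (k + 1) * L := by gcongr
      have hdiff : 0 ≤ (x + 1) ^ k - x ^ k := sub_nonneg.2 (by gcongr; linarith)
      have hE : 1 / (Nat.factorial k : ℝ) * (((x + 1) ^ k - x ^ k) * L) ≤ k * (x + 1) ^ k :=
        (mul_le_of_le_one_left (mul_nonneg hdiff hL0) (one_div_factorial_le_one _)).trans
          ((mul_le_mul_of_nonneg_left hL hdiff).trans (add_one_pow_sub_pow_mul_le x hx0 k))
      set D := (x + 1) ^ (k + 1) - x ^ (k + 1) with hD
      have hk0 : (0 : ℝ) ≤ k := Nat.cast_nonneg _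
      have hCD := mul_le_mul_of_nonneg_left hB (show 0 ≤ C + k by linarith)
      have hTD : 0 ≤ T * D := mul_nonneg hT0 (by linarith)
      have hgoal : 3 + C * (x + 1) ^ k + k * (x + 1) ^ k ≤ (C + 3 + k + T) * D := by linarith
      rw [hD, mul_sub] at hgoal
      linarith

/-! ### Growth of the length factors and conclusion. -/

/-- The threshold is at least 1, and `2 * 251 ≤ 2 ^ 9`. -/
theorem heavyThreshold_factor_le {s d : ℕ} {E : ℝ} (h : (heavyThreshold s d : ℝ) ≤ 2 ^ E) :
    (((heavyThreshold s d + 1) * 251 : ℕ) : ℝ) ≤ 2 ^ (9 + E) := by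
  have h1 : (1 : ℝ) ≤ heavyThreshold s d := by exact_mod_cast heavyThreshold_pos s d
  rw [Real.rpow_add two_pos]
  push_cast
  norm_num
  linarith

theorem lengthFactor_step_le {s d : ℕ} {E F G : ℝ} (h : (heavyThreshold (s + 3) d : ℝ) ≤ 2 ^ E)
    (hF : (lengthFactor (s + 1) d : ℝ) ≤ 2 ^ F) (hG : F + (9 + E) ≤ G) :
    (lengthFactor (s + 3) d : ℝ) ≤ 2 ^ G := by
  rw [lengthFactor, Nat.cast_mul]
  refine le_trans ?_ (Real.rpow_le_rpow_of_exponent_le one_le_two hG)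
  rw [Real.rpow_add two_pos]
  exact mul_le_mul hF (heavyThreshold_factor_le h) (Nat.cast_nonneg _) (by positivity)

theorem lengthFactor_even_le (k : ℕ) : ∃ C : ℝ, 0 ≤ C ∧ ∀ d : ℕ, 1 ≤ d →
    (lengthFactor (2 * k + 4) d : ℝ) ≤
      2 ^ (1 / (Nat.factorial (k + 1) : ℝ) * (d : ℝ) ^ (k + 1) + C * (d : ℝ) ^ k) := by
  induction k with
  | zero =>
    obtain ⟨C, hC, hle⟩ := heavyThreshold_even_le 0
    refine ⟨C + 10, by positivity, fun d hd => ?_⟩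
    obtain ⟨e, rfl⟩ := Nat.exists_eq_add_of_le' hd
    refine lengthFactor_step_le (s := 1) (F := 1) (hle e) (by simp [lengthFactor]) ?_
    rw [pow_zero]
    linarith
  | succ k ih =>
    obtain ⟨C₁, hC₁, hle₁⟩ := ih
    obtain ⟨C, hC, hle⟩ := heavyThreshold_even_le (k + 1)
    refine ⟨1 + C₁ + 9 + C, by positivity, fun d hd => ?_⟩
    have h₁ := hle₁ d hd
    obtain ⟨e, rfl⟩ := Nat.exists_eq_add_of_le' hd
    refine lengthFactor_step_le (s := 2 * k + 3) (hle e) h₁ ?_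
    have hx : (1 : ℝ) ≤ ((e + 1 : ℕ) : ℝ) := by exact_mod_cast hd
    set x : ℝ := ((e + 1 : ℕ) : ℝ)
    have hone : (1 : ℝ) ≤ x ^ (k + 1) := one_le_pow₀ hx
    -- The leading exponent of the factor two orders below has degree `k + 1`, so it falls into the
    -- error term.
    have h2 : 1 / (Nat.factorial (k + 1) : ℝ) * x ^ (k + 1) ≤ x ^ (k + 1) :=
      mul_le_of_le_one_left (by positivity) (one_div_factorial_le_one _)
    have h3 : C₁ * x ^ k ≤ C₁ * x ^ (k + 1) :=
      mul_le_mul_of_nonneg_left (pow_le_pow_right₀ hx (Nat.le_succ k)) hC₁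
    linarith

theorem lengthFactor_odd_le (k : ℕ) : ∃ C : ℝ, 0 ≤ C ∧ ∀ d : ℕ, 1 ≤ d →
    (lengthFactor (2 * k + 3) d : ℝ) ≤
      2 ^ (1 / (Nat.factorial k : ℝ) * (d : ℝ) ^ k * Real.logb 2 (d : ℝ) + C * (d : ℝ) ^ k) := by
  induction k with
  | zero =>
    obtain ⟨C, hC, hle⟩ := heavyThreshold_odd_le 0
    refine ⟨C + 10, by positivity, fun d hd => ?_⟩
    obtain ⟨e, rfl⟩ := Nat.exists_eq_add_of_le' hd
    refine lengthFactor_step_le (s := 0) (F := 1) (hle e) (by simp [lengthFactor]) ?_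
    rw [pow_zero]
    linarith
  | succ k ih =>
    obtain ⟨C₁, hC₁, hle₁⟩ := ih
    obtain ⟨C, hC, hle⟩ := heavyThreshold_odd_le (k + 1)
    refine ⟨1 + C₁ + 9 + C, by positivity, fun d hd => ?_⟩
    have h₁ := hle₁ d hd
    obtain ⟨e, rfl⟩ := Nat.exists_eq_add_of_le' hd
    refine lengthFactor_step_le (s := 2 * k + 2) (hle e) h₁ ?_
    have hx : (1 : ℝ) ≤ ((e + 1 : ℕ) : ℝ) := by exact_mod_cast hd
    set x : ℝ := ((e + 1 : ℕ) : ℝ)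
    have hone : (1 : ℝ) ≤ x ^ (k + 1) := one_le_pow₀ hx
    have h2 : 1 / (Nat.factorial k : ℝ) * x ^ k * Real.logb 2 x ≤ x ^ (k + 1) := by
      rw [pow_succ, mul_assoc]
      have hlog := Real.logb_nonneg one_lt_two hx
      exact (mul_le_of_le_one_left (by positivity) (one_div_factorial_le_one _)).trans
        (mul_le_mul_of_nonneg_left (logb_two_le_self (by linarith)) (by positivity))
    have h3 : C₁ * x ^ k ≤ C₁ * x ^ (k + 1) :=
      mul_le_mul_of_nonneg_left (pow_le_pow_right₀ hx (Nat.le_succ k)) hC₁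
    linarith

theorem mainTheorem1 (s t : ℕ) (hs : 3 ≤ s) (ht : t = (s - 2) / 2) :
    (Even s → ∃ C : ℝ, ∀ n : ℕ, 1 ≤ n →
      (dsLambda s n : ℝ) ≤
        (n : ℝ) * (2 : ℝ) ^ ((1 / (Nat.factorial t : ℝ)) * (invAck n : ℝ) ^ t
          + C * (invAck n : ℝ) ^ (t - 1))) ∧
    (Odd s → ∃ C : ℝ, ∀ n : ℕ, 1 ≤ n →
      (dsLambda s n : ℝ) ≤
        (n : ℝ) * (2 : ℝ) ^ ((1 / (Nat.factorial t : ℝ)) * (invAck n : ℝ) ^ t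
            * Real.logb 2 (invAck n : ℝ)
          + C * (invAck n : ℝ) ^ t)) := by
  have hds : ∀ n, (dsLambda s n : ℝ) ≤ n * lengthFactor s (invAck n) := fun n => by
    exact_mod_cast dsLambda_le s n (by omega)
  constructor
  · rintro ⟨r, hr⟩
    obtain ⟨k, rfl⟩ : ∃ k, s = 2 * k + 4 := ⟨r - 2, by omega⟩
    obtain rfl : t = k + 1 := by omega
    obtain ⟨C, -, hC⟩ := lengthFactor_even_le k
    exact ⟨C, fun n _ => (hds n).trans
      (mul_le_mul_of_nonneg_left (hC _ (isLeast_invAck n).1.1) (Nat.cast_nonneg n))⟩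
  · rintro ⟨r, hr⟩
    obtain ⟨k, rfl⟩ : ∃ k, s = 2 * k + 3 := ⟨r - 1, by omega⟩
    obtain rfl : t = k := by omega
    obtain ⟨C, -, hC⟩ := lengthFactor_odd_le t
    exact ⟨C, fun n _ => (hds n).trans
      (mul_le_mul_of_nonneg_left (hC _ (isLeast_invAck n).1.1) (Nat.cast_nonneg n))⟩
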